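/- **Setting.** Let $n\ge 1$ and let $\mathcal C=\{a_1<\cdots<a_n\}$ be an ordered set of primary colors, $\mathcal C_\rtimes=\{a_ia_j: 1\le i<j\le n\}$ the set of secondary colors. The order is extended to $\mathcal C\sqcup\mathcal C_\rtimes$ by $$a_1a_2<\cdots<a_1a_n<a_1<a_2a_3<\cdots<a_2a_n<a_2<\cdots<a_{n-1}a_n<a_{n-1}<a_n .$$ A colored number $k_p$ consists of an integer $k$ (its size) and a color $p$; $k_p+m=(k+m)_p$. Put $k_p\succ l_q$ iff $k-l\ge\chi(p\le q)$, and let $\succeq$ be the reflexive closure of $\succ$. Let $\mathcal P$ be the set of $k_p$ with $p\in\mathcal C$, $k\ge 1$ (primary parts), and $\mathcal S$ the set of $k_p$ with $p\in\mathcal C_\rtimes$, $k\geq 2$ (secondary parts). Let $\mathcal{SP}_\rtimes$ be the set of the pairs $(a_ka_l,a_ia_j)$ of secondary colors with $i<j<k<l$ or $k<i<j<l$. If $p$ or $q$ is primary, both $k_p\triangleright l_q$ and $k_p\gg l_q$ mean $k_p\succeq(l+1)_q$. If $p,q$ are both secondary, $k_p\triangleright l_q$ means $k_p\succ(l+1)_q$,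 and $k_p\gg l_q$ means $k_p\succ l_q$ when $(p,q)\in\mathcal{SP}_\rtimes$ and $k_p\succ(l+1)_q$ otherwise. Let $\mathcal O$ be the set of finite sequences $\lambda_1\succ\cdots\succ\lambda_t$ of parts in $\mathcal P$, and $\mathcal E$ the set of finite sequences $\nu'_1\gg\cdots\gg\nu'_t$ of parts in $\mathcal P\sqcup\mathcal S$. **The map $\Phi$.** Step 1: in a sequence $\lambda_1,\dots,\lambda_t$, take the smallest $i<t$ with $\lambda_i,\lambda_{i+1}\in\mathcal P$, $\lambda_i\succ\lambda_{i+1}$ and $\lambda_i\not\gg\lambda_{i+1}$, replace the two parts by the single part $\lambda_i+\lambda_{i+1}\in\mathcal S$ (whose size is the sum of the sizes and whose color is the product of the colors), and go to Step 2; if there is no such $i$, stop. Step 2: take the smallest $i<t$ with $\lambda_i\in\mathcal P$, $\lambda_{i+1}\in\mathcal S$ and $\lambda_i\not\gg\lambda_{i+1}$, replace $(\lambda_i,\lambda_{i+1})$ by $(\lambda_{i+1}+1,\lambda_i-1)$, and redo Step 2; if there is no such $i$, go to Step 1. The process, started at Step 1 on $\lambda\in\mathcal O$, terminates; $\Phi(\lambda)$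 is the final sequence. **Enumeration.** A secondary part has an upper half $\alpha$ and a lower half $\beta$: $\alpha((2k)_{a_ia_j})=k_{a_j}$, $\beta((2k)_{a_ia_j})=k_{a_i}$, $\alpha((2k+1)_{a_ia_j})=(k+1)_{a_i}$, $\beta((2k+1)_{a_ia_j})=k_{a_j}$. Let $\nu\in\mathcal E$ have $p$ primary and $s$ secondary parts. Replacing each secondary part by its upper half followed by its lower half gives a sequence $(\nu_1,\dots,\nu_{p+2s})$. Let $J$, $I$, $I+1$ be the sets of indices of the primary parts, of the upper halves and of the lower halves. For $i\in I$ the corresponding secondary part is $\nu_i+\nu_{i+1}$, and $\nu^-(i)$ denotes the part of $\nu$ immediately to its left; if there is none, every relation $\nu^-(i)\,R\,y$ below is regarded as true. Put $$\mathcal{TS}(\nu)=\{i\in I:\ i+2\in I,\ \nu^-(i)\triangleright \nu_i+\nu_{i+1}\not\triangleright\nu_{i+2}+\nu_{i+3}\}.$$ **The Bridge.** Put $\nu_{p+2s+1}=0_{a_n}$. For $i\in I$ let $j=\min\big((i,p+2s+1]\cap(J\cup\{p+2s+1\})\big)$. If $\nu_{i'+1}\not\succ\nu_j+\frac{j-i'}2-1$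 for all $i'\in[i,j)\cap I$, set $\mathbf{Br}_\nu(i)=j$. Otherwise let $\mathcal S_i$ be the set of $u\in(i,j)\cap I$ such that $\nu_{i'+1}\not\succ\nu_u+\frac{u-i'}2-1$ for all $i'\in[i,u)\cap I$; set $\mathbf{Br}_\nu(i)=\max\mathcal S_i$ if $\mathcal S_i\ne\emptyset$ and $\mathbf{Br}_\nu(i)=i$ if $\mathcal S_i=\emptyset$. **Theorem (Explicit definition of $\mathcal E_1=\Phi(\mathcal O)$).** For $\nu\in\mathcal E$ the following are equivalent: 1. $\nu\in\Phi(\mathcal O)$. 2. For every $i\in I$ with $\mathbf{Br}_\nu(i)>i$, $$\nu^-(i)\gg\nu_{\mathbf{Br}_\nu(i)}+\frac{\mathbf{Br}_\nu(i)-i}2\qquad\text{and}\qquad \nu_{\mathbf{Br}_\nu(i)}+\frac{\mathbf{Br}_\nu(i)-i}2\not\succ\nu_i+\nu_{i+1}.$$ 3. For every $i\in\mathcal{TS}(\nu)$ with $\mathbf{Br}_\nu(i)>i$, $$\nu_i+\nu_{i+1}\succ\nu_{\mathbf{Br}_\nu(i)}+\frac{\mathbf{Br}_\nu(i)-i}2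 .$$ -/

import Mathlib

namespace ColoredPartition

/-! ### Colors and colored parts -/

/-- The colors built on the ordered primary colors `a_1 < ⋯ < a_n` (indexed by `Fin n`):
the primary colors `a_i` and the secondary colors `a_i a_j` with `i < j`. -/
inductive Color (n : ℕ) : Type
  | primary (i : Fin n) : Color n
  | secondary (i j : Fin n) (h : i < j) : Color n
  deriving DecidableEq

namespace Color

variable {n : ℕ}

/-- The pair encoding the order of colors:
`a_1a_2 < ⋯ < a_1a_n < a_1 < a_2a_3 < ⋯ < a_2a_n < a_2 < ⋯ < a_{n-1}a_n < a_{n-1} < a_n`. -/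
def key : Color n → ℕ ×ₗ ℕ
  | primary i => toLex (i.val, n)
  | secondary i j _ => toLex (i.val, j.val)

theorem key_injective : Function.Injective (key (n := n)) := by
  rintro (i | ⟨i, j, h⟩) (i' | ⟨i', j', h'⟩) hk <;>
    simp only [key, EmbeddingLike.apply_eq_iff_eq, Prod.mk.injEq] at hk
  · obtain rfl : i = i' := Fin.ext hk.1
    rfl
  · exact absurd hk.2 (by have := j'.isLt; omega)
  · exact absurd hk.2 (by have := j.isLt; omega)
  · obtain rfl : i = i' := Fin.ext hk.1
    obtain rfl : j = j' := Fin.ext hk.2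
    rfl

instance : LinearOrder (Color n) := LinearOrder.lift' key key_injective

/-- The color is primary. -/
def IsPrimary : Color n → Prop
  | primary _ => True
  | secondary _ _ _ => False

/-- The color is secondary. -/
def IsSecondary : Color n → Prop
  | primary _ => False
  | secondary _ _ _ => True

instance : DecidablePred (IsPrimary (n := n))
  | primary _ => inferInstanceAs (Decidable True)
  | secondary _ _ _ => inferInstanceAs (Decidable False)

instance : DecidablePred (IsSecondary (n := n))
  | primary _ => inferInstanceAs (Decidable False)
  | secondary _ _ _ => inferInstanceAs (Decidable True)

/-- The special pairs `(a_k a_l, a_i a_j)` of secondary colors: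
`i < j < k < l` or `k < i < j < l`. -/
def IsSpecialPair : Color n → Color n → Prop
  | secondary k l _, secondary i j _ => (i < j ∧ j < k ∧ k < l) ∨ (k < i ∧ i < j ∧ j < l)
  | _, _ => False

instance (p q : Color n) : Decidable (IsSpecialPair p q) := by
  cases p <;> cases q <;> simp only [IsSpecialPair] <;> infer_instance

/-- The (commutative) product of two distinct primary colors, a secondary color.
There is no product in any other case. -/
def mul? : Color n → Color n → Option (Color n)
  | primary i, primary j =>
      if h : i < j then some (secondary i j h)
      else if h : j < i then some (secondary j i h)
      else none
  | _, _ => none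

end Color

/-- A colored number `k_p`: an integer `k` (its size) with a color `p`. -/
structure Part (n : ℕ) : Type where
  size : ℤ
  color : Color n
  deriving DecidableEq

variable {n : ℕ}

namespace Part

/-- `k_p + m = (k + m)_p`. -/
def shift (x : Part n) (m : ℤ) : Part n := ⟨x.size + m, x.color⟩

/-- Membership in `𝒫`: a primary color and a positive size. -/
def InP (x : Part n) : Prop := x.color.IsPrimary ∧ 1 ≤ x.size

/-- Membership in `𝒮`: a secondary color and a size greater than one. -/
def InS (x : Part n) : Prop := x.color.IsSecondary ∧ 1 < x.size

instance : DecidablePred (InP (n := n)) := fun _ => inferInstanceAs (Decidable (_ ∧ _))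
instance : DecidablePred (InS (n := n)) := fun _ => inferInstanceAs (Decidable (_ ∧ _))

/-- The lexicographic order `≻`: `k_p ≻ l_q` iff `k - l ≥ χ(p ≤ q)`. -/
def LexGt (x y : Part n) : Prop :=
  x.size - y.size ≥ (if x.color ≤ y.color then 1 else 0)

/-- `⪰`, the reflexive closure of `≻`. -/
def LexGe (x y : Part n) : Prop := x.LexGt y ∨ x = y

instance (x y : Part n) : Decidable (x.LexGt y) := inferInstanceAs (Decidable (_ ≥ _))
instance (x y : Part n) : Decidable (x.LexGe y) := inferInstanceAs (Decidable (_ ∨ _))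

/-- The relation `▷`. -/
def Tri (x y : Part n) : Prop :=
  if x.color.IsPrimary ∨ y.color.IsPrimary then x.LexGe (y.shift 1)
  else x.LexGt (y.shift 1)

/-- The relation `≫`. -/
def GG (x y : Part n) : Prop :=
  if x.color.IsPrimary ∨ y.color.IsPrimary then x.LexGe (y.shift 1)
  else if x.color.IsSpecialPair y.color then x.LexGt y
  else x.LexGt (y.shift 1)

instance (x y : Part n) : Decidable (x.Tri y) := by unfold Tri; infer_instance
instance (x y : Part n) : Decidable (x.GG y) := by unfold GG; infer_instance

/-- The upper half `α` of the secondary part `m_{a_i a_j}`: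
`α((2k)_{a_i a_j}) = k_{a_j}` and `α((2k+1)_{a_i a_j}) = (k+1)_{a_i}`. -/
def upperHalf (m : ℤ) (i j : Fin n) : Part n :=
  if Even m then ⟨m / 2, .primary j⟩ else ⟨m / 2 + 1, .primary i⟩

/-- The lower half `β` of the secondary part `m_{a_i a_j}`:
`β((2k)_{a_i a_j}) = k_{a_i}` and `β((2k+1)_{a_i a_j}) = k_{a_j}`. -/
def lowerHalf (m : ℤ) (i j : Fin n) : Part n :=
  if Even m then ⟨m / 2, .primary i⟩ else ⟨m / 2, .primary j⟩

/-- A troublesome pair of primary parts: `x ≻ y` but not `x ≫ y`. -/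
def Troublesome (x y : Part n) : Prop := x.InP ∧ y.InP ∧ x.LexGt y ∧ ¬ x.GG y

/-- A pair in `𝒫 × 𝒮` that has to be crossed: not `x ≫ y`. -/
def ToCross (x y : Part n) : Prop := x.InP ∧ y.InS ∧ ¬ x.GG y

instance (x y : Part n) : Decidable (x.Troublesome y) :=
  inferInstanceAs (Decidable (_ ∧ _ ∧ _ ∧ _))
instance (x y : Part n) : Decidable (x.ToCross y) :=
  inferInstanceAs (Decidable (_ ∧ _ ∧ _))

end Part

/-! ### The sets of partitions `𝒪` and `ℰ` -/

/-- `𝒪`: the partitions `λ_1 ≻ ⋯ ≻ λ_t` with parts in `𝒫`. -/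
def setO (n : ℕ) : Set (List (Part n)) :=
  {l | (∀ x ∈ l, x.InP) ∧ l.IsChain Part.LexGt}

/-- `ℰ`: the partitions `ν_1 ≫ ⋯ ≫ ν_t` with parts in `𝒫 ⊔ 𝒮`. -/
def setE (n : ℕ) : Set (List (Part n)) :=
  {l | (∀ x ∈ l, x.InP ∨ x.InS) ∧ l.IsChain Part.GG}

/-! ### The machine `Φ` -/

/-- One application of Step 1: the first troublesome pair of consecutive parts is replaced by
its sum, seen as a secondary part; `none` if there is no troublesome pair. -/
def step1 : List (Part n) → Option (List (Part n))
  | x :: y :: l =>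
      if x.Troublesome y then
        (Color.mul? x.color y.color).map fun c => ⟨x.size + y.size, c⟩ :: l
      else (step1 (y :: l)).map (x :: ·)
  | _ => none

/-- One application of Step 2: the first consecutive pair `(x, y) ∈ 𝒫 × 𝒮` with not `x ≫ y`
is replaced by `(y + 1, x - 1)`; `none` if there is no such pair. -/
def step2 : List (Part n) → Option (List (Part n))
  | x :: y :: l =>
      if x.ToCross y then some (y.shift 1 :: x.shift (-1) :: l)
      else (step2 (y :: l)).map (x :: ·)
  | _ => none

/-- The number of secondary parts of a sequence. -/
def numSec (l : List (Part n)) : ℕ := l.countP fun x => x.color.IsSecondary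

/-- The number of pairs formed by a primary part and a secondary part to its right. -/
def inversions : List (Part n) → ℕ
  | [] => 0
  | x :: l => (if x.color.IsPrimary then numSec l else 0) + inversions l

theorem step1_length : ∀ {l l' : List (Part n)}, step1 l = some l' → l'.length < l.length
  | [], _, h => by simp [step1] at h
  | [_], _, h => by simp [step1] at h
  | x :: y :: l, l', h => by
      rw [step1] at h
      split_ifs at h with hT
      · obtain ⟨c, -, rfl⟩ := Option.map_eq_some_iff.1 h
        simp
      · obtain ⟨m, hm, rfl⟩ := Option.map_eq_some_iff.1 h
        have := step1_length hm
        simp only [List.length_cons] at this ⊢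
        omega

theorem step2_spec : ∀ {l l' : List (Part n)}, step2 l = some l' →
    l'.length = l.length ∧ numSec l' = numSec l ∧ inversions l' < inversions l
  | [], _, h => by simp [step2] at h
  | [_], _, h => by simp [step2] at h
  | x :: y :: l, l', h => by
      rw [step2] at h
      split_ifs at h with hT
      · obtain rfl := Option.some.inj h
        obtain ⟨⟨hx, -⟩, ⟨hy, -⟩, -⟩ := hT
        have hx' : ¬ x.color.IsSecondary := by
          rcases x with ⟨m, _ | _⟩ <;> simp_all [Color.IsPrimary, Color.IsSecondary]
        have hy' : ¬ y.color.IsPrimary := by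
          rcases y with ⟨m, _ | _⟩ <;> simp_all [Color.IsPrimary, Color.IsSecondary]
        refine ⟨rfl, ?_, ?_⟩ <;>
          simp [numSec, inversions, Part.shift, hx, hy, hx', hy']
      · obtain ⟨m, hm, rfl⟩ := Option.map_eq_some_iff.1 h
        obtain ⟨h1, h2, h3⟩ := step2_spec hm
        refine ⟨by simp [h1], ?_, ?_⟩
        · simp only [numSec, List.countP_cons] at h2 ⊢
          omega
        · rw [inversions, inversions, h2]
          omega

/-- Step 2 repeated as long as possible. -/
def iterStep2 (l : List (Part n)) : List (Part n) :=
  match _h : step2 l with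
  | some l' => iterStep2 l'
  | none => l
termination_by inversions l
decreasing_by exact (step2_spec _h).2.2

theorem iterStep2_length (l : List (Part n)) : (iterStep2 l).length = l.length := by
  induction l using iterStep2.induct with
  | case1 l l' h ih => rw [iterStep2]; split <;> simp_all [(step2_spec h).1]
  | case2 l h => rw [iterStep2]; split <;> simp_all

/-- The machine `Φ`: apply Step 1 once, then Step 2 as long as possible, and start again;
exit when Step 1 does not apply. -/
def machinePhi (l : List (Part n)) : List (Part n) :=
  match _h : step1 l with
  | some l' => machinePhi (iterStep2 l')
  | none => l
termination_by l.length
decreasing_by rw [iterStep2_length]; exact step1_length _h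

/-! ### Enumeration of the primary parts and of the halves of the secondary parts

Indices start at `0` (all indices are one less than in the enumeration starting at `1`, so that
differences of indices are the same): a partition `ν` with `p` primary and `s` secondary parts is enumerated as
`ν_0, …, ν_{p+2s-1}`. -/

/-- The three kinds of entries in the enumeration. -/
inductive Kind : Type
  | whole | upper | lower
  deriving DecidableEq

/-- A primary part gives one entry, a secondary part gives its two halves. -/
def Part.entries (x : Part n) : List (Part n × Kind) :=
  match x.color with
  | .primary _ => [(x, .whole)]
  | .secondary i j _ =>
      [(Part.upperHalf x.size i j, .upper), (Part.lowerHalf x.size i j, .lower)]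

/-- The sequence `(ν_k)` of all entries, each with its kind. -/
def enum (ν : List (Part n)) : List (Part n × Kind) := ν.flatMap Part.entries

/-- `J`: the indices of the primary parts. -/
def setJ (ν : List (Part n)) : Finset ℕ :=
  (Finset.range (enum ν).length).filter fun k => ((enum ν).map Prod.snd)[k]? = some .whole

/-- `I`: the indices of the upper halves of the secondary parts. -/
def setI (ν : List (Part n)) : Finset ℕ :=
  (Finset.range (enum ν).length).filter fun k => ((enum ν).map Prod.snd)[k]? = some .upper

/-- The position in the list `ν` of the part to which the entry of index `k ∈ I ∪ J` belongs. -/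
def partPos (ν : List (Part n)) (k : ℕ) : ℕ := k - ((setI ν).filter (· < k)).card

theorem exists_next (ν : List (Part n)) (i : ℕ) :
    ∃ j, i < j ∧ (j ∈ setJ ν ∨ (enum ν).length ≤ j) :=
  ⟨max (i + 1) (enum ν).length, by omega, by omega⟩

section Bridge

variable [NeZero n]

/-- The colored number `0_{a_n}`. -/
def zeroPart (n : ℕ) [NeZero n] : Part n := ⟨0, .primary ⊤⟩

/-- The entry `ν_k`, with the convention `ν_{p+2s} = 0_{a_n}` just after the last entry. -/
def entry (ν : List (Part n)) (k : ℕ) : Part n :=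
  ((enum ν).map Prod.fst).getD k (zeroPart n)

/-- For `i ∈ I`, the secondary part `ν_i + ν_{i+1}`. -/
def secPart (ν : List (Part n)) (i : ℕ) : Part n := ν.getD (partPos ν i) (zeroPart n)

/-- For `i ∈ I`, the part `ν⁻(i)` just to the left of `ν_i + ν_{i+1}`;
`none` if `ν_i + ν_{i+1}` is the first part. -/
def leftPart (ν : List (Part n)) (i : ℕ) : Option (Part n) :=
  if partPos ν i = 0 then none else ν[partPos ν i - 1]?

/-- `ν⁻(i) R y`, with the convention that it holds when there is no part to the left
(which amounts to an infinite part `ν⁻(i)`). -/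
def LeftRel (R : Part n → Part n → Prop) (ν : List (Part n)) (i : ℕ) (y : Part n) : Prop :=
  ∀ x, leftPart ν i = some x → R x y

/-- For `i ∈ I`, the index of the greatest primary part to the right of `ν_i + ν_{i+1}`, or
`p + 2s` (the index just after the last entry) if there is none. -/
def nextPrimary (ν : List (Part n)) (i : ℕ) : ℕ := Nat.find (exists_next ν i)

/-- For all `i' ∈ [i, u) ∩ I`, one has `ν_{i'+1} ⊁ ν_u + (u - i')/2 - 1`. -/
def Crossing (ν : List (Part n)) (i u : ℕ) : Prop :=
  ∀ i' ∈ setI ν, i ≤ i' → i' < u →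
    ¬ (entry ν (i' + 1)).LexGt ((entry ν u).shift (((u : ℤ) - i') / 2 - 1))

instance (ν : List (Part n)) (i u : ℕ) : Decidable (Crossing ν i u) := by
  unfold Crossing; infer_instance

/-- The set `𝒮_i` of the candidates for the Bridge of `i` among the indices of upper halves. -/
def candidates (ν : List (Part n)) (i : ℕ) : Finset ℕ :=
  (setI ν).filter fun u => i < u ∧ u < nextPrimary ν i ∧ Crossing ν i u

/-- The Bridge `Br_ν(i)` of an index `i ∈ I`. -/
def bridge (ν : List (Part n)) (i : ℕ) : ℕ :=
  if Crossing ν i (nextPrimary ν i) then nextPrimary ν i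
  else if h : (candidates ν i).Nonempty then (candidates ν i).max' h
  else i

/-- The part `ν_{Br(i)} + (Br(i) - i)/2`. -/
def bridgePart (ν : List (Part n)) (i : ℕ) : Part n :=
  (entry ν (bridge ν i)).shift (((bridge ν i : ℤ) - i) / 2)

/-- `𝒯𝒮(ν)`: the indices of the troublesome secondary parts, those with
`ν⁻(i) ▷ ν_i + ν_{i+1}` but not `ν_i + ν_{i+1} ▷ ν_{i+2} + ν_{i+3}`. -/
def troublesomeSec (ν : List (Part n)) : Set ℕ :=
  {i | i ∈ setI ν ∧ LeftRel Part.Tri ν i (secPart ν i) ∧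
    i + 2 ∈ setI ν ∧ ¬ (secPart ν i).Tri (secPart ν (i + 2))}

end Bridge

end ColoredPartition

open ColoredPartition

/-! The sums made by the machine can be undone. Take the secondary parts of ν from right to left.
Each such part y meets only primary parts on its right. While the next part x is at least the lower
half of y, replace (y, x) by (x + 1, y - 1); as soon as the lower half exceeds the next part, split
y into its halves. The result `expandAll [] ν` is the candidate preimage. Two things may go wrong: a
part may fail to be ≫ the first part of the split tail on its right, or a secondary part may not be
split properly. `Good` excludes both.

A good ν is rebuilt by the machine from its split sequence, which lies in 𝒪
(`machinePhi_expandAll`). Conversely, being good is an invariant of the machine on its processed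
prefix (`good_machinePhi`). Hence the image of 𝒪 consists of the good sequences
(`mem_image_machinePhi_iff`).

Crossing a primary part turns the halves (up, lo) of y into (lo, up - 1). Expressed by halves, y ≫ w
is unchanged when both parts are lowered by one (`gg_iff_halves`); this is the role of the special
pairs. Consequently the proper splitting of a secondary part is automatic (`stops_expandAll`), and
only the first part t of each split tail matters, computed by `top`. Being good means: whenever t is
at least the lower half of the secondary part y before it, t + 1 is below y and the left neighbor of
y is ≫ t + 1 (`good_iff_crossCondition`). The Bridge is a description of t by indices: Br(i) > i
says that t crosses y, and the bridge part is then t + 1 (`crossing_spec`, `bridge_length`,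
`bridgePart_length`). This is condition 2.

For condition 3, the inequality t + 1 ≺ y passes from a secondary part to its right neighbor when ▷
fails between them, and from right to left when ▷ holds. It therefore suffices to test it at the
left end of each run of failures of ▷ (`crossCondition_iff`). -/

namespace ColoredPartition

variable {n : ℕ}

/-! ### An integer encoding of the order of colored numbers -/

namespace Color

theorem isSecondary_iff (p : Color n) : p.IsSecondary ↔ ¬ p.IsPrimary := by
  cases p <;> simp [IsPrimary, IsSecondary]

/-- The first coordinate of the key of a color. -/
def fstIdx : Color n → ℤ
  | primary i => i.val
  | secondary i _ _ => i.val

/-- The second coordinate of the key of a color. -/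
def sndIdx : Color n → ℤ
  | primary _ => n
  | secondary _ j _ => j.val

theorem lt_iff (p q : Color n) :
    p < q ↔ p.fstIdx < q.fstIdx ∨ (p.fstIdx = q.fstIdx ∧ p.sndIdx < q.sndIdx) := by
  change p.key < q.key ↔ _
  cases p <;> cases q <;> simp [key, fstIdx, sndIdx, Prod.Lex.toLex_lt_toLex]

theorem idx_bounds (p : Color n) :
    0 ≤ p.fstIdx ∧ p.fstIdx < n ∧ 0 ≤ p.sndIdx ∧ p.sndIdx ≤ n := by
  rcases p with i | ⟨i, j, h⟩ <;> simp [fstIdx, sndIdx]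

end Color

/-- The number of codes of colors. -/
def period (n : ℕ) : ℤ := (n + 1) * (n + 1)

theorem period_pos : 0 < period n := by unfold period; positivity

namespace Part

/-- An integer that encodes a colored number, compatible with `≻`. -/
def val (x : Part n) : ℤ :=
  x.size * period n + (x.color.fstIdx * (n + 1) + x.color.sndIdx)

theorem val_shift (x : Part n) (m : ℤ) : (x.shift m).val = x.val + m * period n := by
  simp only [val, shift]; ring

@[simp] theorem val_shift_one (x : Part n) : (x.shift 1).val = x.val + period n := by
  rw [val_shift]; ring

@[simp] theorem val_shift_neg_one (x : Part n) : (x.shift (-1)).val = x.val - period n := by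
  rw [val_shift]; ring

@[simp] theorem shift_size (x : Part n) (m : ℤ) : (x.shift m).size = x.size + m := rfl

theorem shift_shift (x : Part n) (a b : ℤ) : (x.shift a).shift b = x.shift (a + b) := by
  simp [shift, add_assoc]

@[simp] theorem shift_zero (x : Part n) : x.shift 0 = x := by simp [shift]

@[simp] theorem shift_one_neg_one (x : Part n) : (x.shift 1).shift (-1) = x := by
  simp [shift]

@[simp] theorem shift_neg_one_one (x : Part n) : (x.shift (-1)).shift 1 = x := by
  simp [shift]

theorem val_lt_of_size_lt {x y : Part n} (h : x.size < y.size) : x.val < y.val := by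
  obtain ⟨a0, a1, b0, b1⟩ := x.color.idx_bounds
  obtain ⟨c0, c1, d0, d1⟩ := y.color.idx_bounds
  have h1 : (x.size + 1) * period n ≤ y.size * period n :=
    mul_le_mul_of_nonneg_right h period_pos.le
  have h2 : (x.color.fstIdx + 1) * ((n : ℤ) + 1) ≤ n * (n + 1) :=
    mul_le_mul_of_nonneg_right a1 (by positivity)
  have h3 : 0 ≤ y.color.fstIdx * ((n : ℤ) + 1) := by positivity
  have h4 : period n = n * (n + 1) + n + 1 := by unfold period; ring
  unfold val
  linarith

theorem val_lt_of_fst_lt {x y : Part n} (h : x.size = y.size)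
    (h' : x.color.fstIdx < y.color.fstIdx) : x.val < y.val := by
  obtain ⟨a0, a1, b0, b1⟩ := x.color.idx_bounds
  obtain ⟨c0, c1, d0, d1⟩ := y.color.idx_bounds
  have h2 : (x.color.fstIdx + 1) * ((n : ℤ) + 1) ≤ y.color.fstIdx * (n + 1) :=
    mul_le_mul_of_nonneg_right h' (by positivity)
  unfold val
  rw [h]
  linarith

theorem val_lt_iff (x y : Part n) : x.val < y.val ↔ x.size < y.size ∨ (x.size = y.size ∧
    (x.color.fstIdx < y.color.fstIdx ∨
      (x.color.fstIdx = y.color.fstIdx ∧ x.color.sndIdx < y.color.sndIdx))) := by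
  rcases lt_trichotomy x.size y.size with h | h | h
  · simp [h, val_lt_of_size_lt h]
  · rcases lt_trichotomy x.color.fstIdx y.color.fstIdx with h' | h' | h'
    · simp [h, h', val_lt_of_fst_lt h h']
    · simp [val, h, h']
    · have := val_lt_of_fst_lt h.symm h'
      simp [h, h'.not_gt, h'.ne', this.le]
  · have := val_lt_of_size_lt h
    simp [h.not_gt, h.ne', this.le]

theorem val_injective : Function.Injective (val (n := n)) := by
  intro x y h
  have h1 := val_lt_iff x y
  have h2 := val_lt_iff y x
  rw [h] at h1 h2
  have h3 := x.color.lt_iff y.color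
  have h4 := y.color.lt_iff x.color
  have hs : x.size = y.size := by omega
  have hc : x.color = y.color := by
    rcases lt_trichotomy x.color y.color with h5 | h5 | h5
    · have := h3.1 h5; omega
    · exact h5
    · have := h4.1 h5; omega
  cases x; cases y; simp_all

theorem lexGt_iff (x y : Part n) : x.LexGt y ↔ y.val < x.val := by
  rw [val_lt_iff, ← Color.lt_iff]
  unfold LexGt
  rcases lt_or_ge y.color x.color with h | h
  · rw [if_neg h.not_ge]; simp only [h, and_true]; omega
  · rw [if_pos h]; simp only [h.not_gt, and_false, or_false]; omega

theorem lexGe_iff (x y : Part n) : x.LexGe y ↔ y.val ≤ x.val := by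
  unfold LexGe
  rw [lexGt_iff, le_iff_lt_or_eq, val_injective.eq_iff, eq_comm (a := y)]

/-- A relation ≫ that involves a primary part is a non-strict inequality of codes. Distinct kinds of
colors exclude equality, which makes it strict. -/
theorem val_ne_of_isPrimary {x y : Part n} (hx : x.color.IsPrimary)
    (hy : ¬ y.color.IsPrimary) : x.val ≠ y.val := fun h =>
  hy (val_injective h ▸ hx)

theorem gg_iff_of_isPrimary {x y : Part n} (h : x.color.IsPrimary ∨ y.color.IsPrimary) :
    x.GG y ↔ y.val + period n ≤ x.val := by
  rw [GG, if_pos h, lexGe_iff, val_shift_one]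

theorem tri_iff_of_isPrimary {x y : Part n} (h : x.color.IsPrimary ∨ y.color.IsPrimary) :
    x.Tri y ↔ y.val + period n ≤ x.val := by
  rw [Tri, if_pos h, lexGe_iff, val_shift_one]

theorem tri_iff_of_not_isPrimary {x y : Part n} (hx : ¬ x.color.IsPrimary)
    (hy : ¬ y.color.IsPrimary) : x.Tri y ↔ y.val + period n < x.val := by
  rw [Tri, if_neg (by tauto), lexGt_iff, val_shift_one]

theorem gg_of_tri {x y : Part n} (h : x.Tri y) : x.GG y := by
  by_cases h0 : x.color.IsPrimary ∨ y.color.IsPrimary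
  · rwa [gg_iff_of_isPrimary h0, ← tri_iff_of_isPrimary h0]
  · have h1 := h
    rw [Tri, if_neg h0] at h1
    rw [GG, if_neg h0]
    split_ifs
    · rw [lexGt_iff, val_shift_one] at h1
      rw [lexGt_iff]
      have := period_pos (n := n)
      omega
    · exact h1

theorem gg_of_val {x y : Part n} (hx : ¬ x.color.IsPrimary) (h : y.val + period n < x.val) :
    x.GG y := by
  by_cases hy : y.color.IsPrimary
  · rw [gg_iff_of_isPrimary (.inr hy)]; omega
  · exact gg_of_tri ((tri_iff_of_not_isPrimary hx hy).2 h)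

/-- The relation `≫` implies `≻`. -/
theorem val_lt_of_gg {x y : Part n} (h : x.GG y) : y.val < x.val := by
  have := period_pos (n := n)
  unfold GG at h
  split_ifs at h <;> simp only [lexGe_iff, lexGt_iff, val_shift_one] at h <;> omega

/-! ### Halves -/

/-- The upper half of a secondary part. -/
def up (y : Part n) : Part n :=
  match y.color with
  | .primary _ => y
  | .secondary i j _ => upperHalf y.size i j

/-- The lower half of a secondary part. -/
def lo (y : Part n) : Part n :=
  match y.color with
  | .primary _ => y
  | .secondary i j _ => lowerHalf y.size i j

theorem up_isPrimary (y : Part n) : y.up.color.IsPrimary := by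
  rcases y with ⟨m, i | ⟨i, j, h⟩⟩ <;> simp only [up, upperHalf]
  · trivial
  · split_ifs <;> trivial

theorem lo_isPrimary (y : Part n) : y.lo.color.IsPrimary := by
  rcases y with ⟨m, i | ⟨i, j, h⟩⟩ <;> simp only [lo, lowerHalf]
  · trivial
  · split_ifs <;> trivial

@[simp] theorem up_even (k : ℤ) (i j : Fin n) (h : i < j) :
    (⟨2 * k, .secondary i j h⟩ : Part n).up = ⟨k, .primary j⟩ := by
  simp [up, upperHalf]

@[simp] theorem up_odd (k : ℤ) (i j : Fin n) (h : i < j) :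
    (⟨2 * k + 1, .secondary i j h⟩ : Part n).up = ⟨k + 1, .primary i⟩ := by
  have h2 : ¬ Even (2 * k + 1) := by simp [parity_simps]
  have h3 : (2 * k + 1) / 2 = k := by omega
  simp [up, upperHalf, h2, h3]

@[simp] theorem lo_even (k : ℤ) (i j : Fin n) (h : i < j) :
    (⟨2 * k, .secondary i j h⟩ : Part n).lo = ⟨k, .primary i⟩ := by
  simp [lo, lowerHalf]

@[simp] theorem lo_odd (k : ℤ) (i j : Fin n) (h : i < j) :
    (⟨2 * k + 1, .secondary i j h⟩ : Part n).lo = ⟨k, .primary j⟩ := by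
  have h2 : ¬ Even (2 * k + 1) := by simp [parity_simps]
  have h3 : (2 * k + 1) / 2 = k := by omega
  simp [lo, lowerHalf, h2, h3]

theorem exists_parity {y : Part n} (hy : ¬ y.color.IsPrimary) :
    ∃ (k : ℤ) (i j : Fin n) (h : i < j),
      y = ⟨2 * k, .secondary i j h⟩ ∨ y = ⟨2 * k + 1, .secondary i j h⟩ := by
  rcases y with ⟨m, i | ⟨i, j, h⟩⟩
  · exact absurd trivial hy
  · rcases Int.even_or_odd' m with ⟨k, rfl | rfl⟩
    · exact ⟨k, i, j, h, .inl rfl⟩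
    · exact ⟨k, i, j, h, .inr rfl⟩

/-- Together with `lo_shift_neg_one`: crossing one primary part advances the halves along the
sequence up, lo, up - 1, lo - 1, …, which is decreasing. -/
theorem up_shift_neg_one {y : Part n} (hy : ¬ y.color.IsPrimary) :
    (y.shift (-1)).up = y.lo := by
  obtain ⟨k, i, j, h, rfl | rfl⟩ := exists_parity hy
  · rw [shift, show (2 * k + -1 : ℤ) = 2 * (k - 1) + 1 by ring]; simp
  · simp [shift]

theorem lo_shift_neg_one {y : Part n} (hy : ¬ y.color.IsPrimary) :
    (y.shift (-1)).lo = y.up.shift (-1) := by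
  obtain ⟨k, i, j, h, rfl | rfl⟩ := exists_parity hy
  · rw [shift, show (2 * k + -1 : ℤ) = 2 * (k - 1) + 1 by ring]; simp [shift]; ring
  · simp [shift]

theorem lo_lt_up {y : Part n} (hy : ¬ y.color.IsPrimary) : y.lo.val < y.up.val := by
  obtain ⟨k, i, j, h, rfl | rfl⟩ := exists_parity hy <;>
  simp [val_lt_iff, Color.fstIdx, Color.sndIdx, h]

theorem up_lt_lo_add {y : Part n} (hy : ¬ y.color.IsPrimary) :
    y.up.val < y.lo.val + period n := by
  have h := lo_lt_up (y := y.shift (-1)) hy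
  rw [lo_shift_neg_one hy, up_shift_neg_one hy, val_shift_neg_one] at h
  omega

/-- Two secondary parts are well related iff the halves of the left one exceed those of the
right one, possibly after crossing its upper half. -/
theorem gg_iff_halves {y w : Part n} (hy : ¬ y.color.IsPrimary) (hw : ¬ w.color.IsPrimary) :
    y.GG w ↔ w.up.val < y.lo.val ∨ w.lo.val + period n < y.up.val := by
  rw [← val_shift_one, GG, if_neg (by tauto)]
  obtain ⟨k, i, j, h, rfl | rfl⟩ := exists_parity hy <;>
  obtain ⟨k', i', j', h', rfl | rfl⟩ := exists_parity hw <;>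
  split_ifs with hs <;>
  simp only [lexGt_iff, val_lt_iff, up_even, up_odd, lo_even, lo_odd, Color.IsSpecialPair, shift,
    Color.fstIdx, Color.sndIdx] at hs ⊢ <;> omega

/-- Here ≫ holds only through the special-pair exception, so w ≺ y and y ⊁ w + 1. The consequence
for the machine: a part t that crosses w becomes t + 1, which is at least the lower half of y, so it
crosses y as well. -/
theorem lo_le_of_not_tri {y w : Part n} (hy : ¬ y.color.IsPrimary) (hw : ¬ w.color.IsPrimary)
    (h : y.GG w) (h' : ¬ y.Tri w) : y.lo.val ≤ w.lo.val + period n := by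
  rw [← not_lt, ← val_shift_one]
  rw [GG, if_neg (by tauto)] at h
  rw [Tri, if_neg (by tauto)] at h'
  obtain ⟨k, i, j, hc, rfl | rfl⟩ := exists_parity hy <;>
  obtain ⟨k', i', j', hc', rfl | rfl⟩ := exists_parity hw <;>
  split_ifs at h with hs <;>
  simp only [lexGt_iff, val_lt_iff, lo_even, lo_odd, Color.IsSpecialPair, shift,
    Color.fstIdx, Color.sndIdx] at h h' hs ⊢ <;> omega

/-- A part well related to a secondary part is well related to its upper half. -/
theorem gg_up_of_gg {q y : Part n} (hy : y.InS) (h : q.GG y) : q.GG y.up := by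
  rw [gg_iff_of_isPrimary (.inr y.up_isPrimary), ← val_shift_one]
  obtain ⟨hy, hs⟩ := hy
  rw [Color.isSecondary_iff] at hy
  have hlt := val_lt_of_gg h
  by_cases hq : q.color.IsPrimary
  · rw [gg_iff_of_isPrimary (.inl hq), ← val_shift_one] at h
    rw [← not_lt] at h ⊢
    obtain ⟨k', i', j', hc', rfl | rfl⟩ := exists_parity hy <;>
    simp only [val_lt_iff, up_even, up_odd, shift, Color.fstIdx, Color.sndIdx] at h hs ⊢ <;> omega
  · rw [← not_lt]
    rw [GG, if_neg (by tauto)] at h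
    obtain ⟨k, i, j, hc, rfl | rfl⟩ := exists_parity hq <;>
    obtain ⟨k', i', j', hc', rfl | rfl⟩ := exists_parity hy <;>
    split_ifs at h with hs' <;>
    simp only [lexGt_iff, val_lt_iff, up_even, up_odd, Color.IsSpecialPair, shift,
      Color.fstIdx, Color.sndIdx] at h hs hs' ⊢ <;> omega

theorem up_val_lt {y : Part n} (hy : y.InS) : y.up.val < y.val := by
  obtain ⟨hy, hs⟩ := hy
  rw [Color.isSecondary_iff] at hy
  obtain ⟨k', i', j', hc', rfl | rfl⟩ := exists_parity hy <;>
  simp only [val_lt_iff, up_even, up_odd, Color.fstIdx, Color.sndIdx] at hs ⊢ <;> omega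

theorem lo_size_pos_iff {y : Part n} (hy : ¬ y.color.IsPrimary) : 1 ≤ y.lo.size ↔ 1 < y.size := by
  obtain ⟨k', i', j', hc', rfl | rfl⟩ := exists_parity hy <;> simp <;> omega

theorem lo_size_le_up_size {y : Part n} (hy : ¬ y.color.IsPrimary) : y.lo.size ≤ y.up.size := by
  obtain ⟨k', i', j', hc', rfl | rfl⟩ := exists_parity hy <;> simp

theorem not_isPrimary_of_inS {y : Part n} (h : y.InS) : ¬ y.color.IsPrimary :=
  (Color.isSecondary_iff _).1 h.1

/-- After crossing a primary part, a secondary part keeps a size greater than one. -/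
theorem inS_shift_neg_one {x y : Part n} (hy : y.InS) (hx : x.InP)
    (hxy : x.val + period n ≤ y.val) (hc : y.lo.val ≤ x.val) : (y.shift (-1)).InS := by
  obtain ⟨hy, hs⟩ := hy
  obtain ⟨hx, hs'⟩ := hx
  rw [← val_shift_one, ← not_lt, val_lt_iff] at hxy
  rw [← not_lt, val_lt_iff] at hc
  refine ⟨hy, ?_⟩
  rw [Color.isSecondary_iff] at hy
  rcases x with ⟨m, i | ⟨i, j, _⟩⟩
  swap
  · exact absurd hx (by simp [Color.IsPrimary])
  obtain ⟨k', i', j', hc', rfl | rfl⟩ := exists_parity hy <;>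
  simp only [lo_even, lo_odd, shift, Color.fstIdx, Color.sndIdx] at hs hs' hxy hc ⊢ <;> omega

/-! ### Troublesome pairs -/

theorem troublesome_halves {y : Part n} (hy : y.InS) : y.up.Troublesome y.lo := by
  have hp := not_isPrimary_of_inS hy
  have hs := (lo_size_pos_iff hp).2 hy.2
  refine ⟨⟨y.up_isPrimary, hs.trans (lo_size_le_up_size hp)⟩, ⟨y.lo_isPrimary, hs⟩, ?_, ?_⟩
  · rw [lexGt_iff]; exact lo_lt_up hp
  · rw [gg_iff_of_isPrimary (.inl y.up_isPrimary)]
    have := up_lt_lo_add hp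
    omega

theorem mul?_halves {y : Part n} (hy : ¬ y.color.IsPrimary) :
    (Color.mul? y.up.color y.lo.color).map (fun c => (⟨y.up.size + y.lo.size, c⟩ : Part n)) =
      some y := by
  obtain ⟨k, i, j, h, rfl | rfl⟩ := exists_parity hy <;>
  simp [Color.mul?, h, h.not_gt] <;> omega

/-- Every troublesome pair consists of the halves of its sum. -/
theorem exists_of_troublesome {x z : Part n} (h : x.Troublesome z) :
    ∃ y : Part n, y.InS ∧ y.up = x ∧ y.lo = z := by
  obtain ⟨⟨hx, hxs⟩, ⟨hz, hzs⟩, h1, h2⟩ := h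
  rw [gg_iff_of_isPrimary (.inl hx), ← val_shift_one, not_le] at h2
  rw [lexGt_iff] at h1
  rw [val_lt_iff] at h1 h2
  rcases x with ⟨m, i | ⟨i, j, _⟩⟩
  swap
  · exact absurd hx (by simp [Color.IsPrimary])
  rcases z with ⟨m', i' | ⟨i', j', _⟩⟩
  swap
  · exact absurd hz (by simp [Color.IsPrimary])
  simp only [Color.fstIdx, Color.sndIdx, shift] at h1 h2 hxs hzs
  -- A troublesome pair satisfies z ≺ x ≺ z + 1. Either the sizes agree and x has the larger color,
  -- or they differ by one and x has the smaller color: the patterns of halves for even and odd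
  -- size.
  by_cases hm : m = m'
  · subst hm
    exact ⟨⟨2 * m, .secondary i' i (by omega)⟩, ⟨trivial, by dsimp only; omega⟩, by simp, by simp⟩
  · obtain rfl : m = m' + 1 := by omega
    exact ⟨⟨2 * m' + 1, .secondary i i' (by omega)⟩, ⟨trivial, by dsimp only; omega⟩,
      by simp, by simp⟩

end Part

open ColoredPartition.Part

/-! ### Undoing the sums -/

/-- Move the secondary part `y` to the right through the primary parts of a sequence, as long as
its lower half does not exceed the next part, and split it into its halves. -/
def expand : Part n → List (Part n) → List (Part n)
  | y, [] => [y.up, y.lo]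
  | y, x :: R =>
      if x.val < y.lo.val then y.up :: y.lo :: x :: R
      else x.shift 1 :: expand (y.shift (-1)) R

/-- Split all the secondary parts of a sequence followed by `T`, from right to left. -/
def expandAll (T : List (Part n)) : List (Part n) → List (Part n)
  | [] => T
  | x :: σ => if x.color.IsPrimary then x :: expandAll T σ else expand x (expandAll T σ)

/-- The first part of `expandAll T σ`, where `b` is the first part of `T`. -/
def top (b : Part n) : List (Part n) → Part n
  | [] => b
  | x :: σ =>
      if x.color.IsPrimary then x
      else if (top b σ).val < x.lo.val then x.up else (top b σ).shift 1

/-- The secondary part `y`, moved to the right through a sequence followed by `b`, is split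
within the sequence, after having crossed only well related primary parts. -/
def Stops (b : Part n) : Part n → List (Part n) → Prop
  | y, [] => b.val < y.lo.val
  | y, x :: R => x.val < y.lo.val ∨
      ((∀ z ∈ R.head?, x.GG z ∨ z.val < (y.shift (-1)).lo.val) ∧ Stops b (y.shift (-1)) R)

/-- Every part of a sequence is well related to the part that follows it once the parts to its
right are split, and every secondary part is split before `b`. -/
def Good (b : Part n) (T : List (Part n)) : List (Part n) → Prop
  | [] => True
  | x :: σ => (∀ z ∈ (expandAll T σ).head?, x.GG z) ∧
      (¬ x.color.IsPrimary → Stops b x (expandAll T σ)) ∧ Good b T σ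

theorem head?_expand (y : Part n) (R : List (Part n)) :
    (expand y R).head? = some y.up ∨
      ∃ x ∈ R.head?, y.lo.val ≤ x.val ∧ (expand y R).head? = some (x.shift 1) := by
  rcases R with _ | ⟨x, R⟩
  · simp [expand]
  · rw [expand]
    split_ifs with h
    · simp
    · simpa using Or.inr (not_lt.1 h)

theorem up_le_of_mem_head?_expand {y h : Part n} {R : List (Part n)} (hy : ¬ y.color.IsPrimary)
    (hh : h ∈ (expand y R).head?) : y.up.val ≤ h.val := by
  rcases head?_expand y R with h1 | ⟨x, -, hx, h1⟩ <;> rw [h1] at hh <;>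
    obtain rfl := Option.some.inj hh
  · exact le_rfl
  · have := up_lt_lo_add hy
    rw [val_shift_one]; omega

theorem expand_ne_nil (y : Part n) (R : List (Part n)) : expand y R ≠ [] := by
  intro h
  rcases head?_expand y R with h1 | ⟨x, -, hx, h1⟩ <;> simp [h] at h1

theorem expandAll_append (T σ τ : List (Part n)) :
    expandAll T (σ ++ τ) = expandAll (expandAll T τ) σ := by
  induction σ with
  | nil => rfl
  | cons x σ ih => simp [expandAll, ih]

theorem good_append {b : Part n} {T σ τ : List (Part n)} :
    Good b T (σ ++ τ) ↔ Good b (expandAll T τ) σ ∧ Good b T τ := by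
  induction σ with
  | nil => simp [Good]
  | cons x σ ih => simp [Good, ih, expandAll_append, and_assoc]

theorem Good.gg_of_getLast? {b : Part n} {T Q : List (Part n)} (h : Good b T Q) :
    ∀ x ∈ Q.getLast?, ∀ z ∈ T.head?, x.GG z := by
  intro x hx z hz
  obtain ⟨Q, rfl⟩ := List.getLast?_eq_some_iff.1 hx
  exact (good_append.1 h).2.1 z hz

theorem expandAll_eq_append {T σ : List (Part n)} (h : ∀ x ∈ σ, x.color.IsPrimary) :
    expandAll T σ = σ ++ T := by
  induction σ with
  | nil => rfl
  | cons x σ ih =>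
    simp only [List.mem_cons, forall_eq_or_imp] at h
    simp [expandAll, h.1, ih h.2]

theorem good_of_isChain {b : Part n} {σ : List (Part n)} (h : ∀ x ∈ σ, x.color.IsPrimary)
    (hσ : σ.IsChain GG) : Good b [] σ := by
  induction σ with
  | nil => trivial
  | cons x σ ih =>
    simp only [List.mem_cons, forall_eq_or_imp] at h
    rw [List.isChain_cons] at hσ
    refine ⟨?_, fun hx => absurd h.1 hx, ih h.2 hσ.2⟩
    rw [expandAll_eq_append h.2, List.append_nil]
    exact hσ.1

/-- `top` and `expand` follow the same test. They could differ only when y would cross b behind an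
empty split tail, and `Stops` excludes this. -/
theorem Good.top_eq {b : Part n} {σ : List (Part n)} (h : Good b [] σ) :
    top b σ = (expandAll [] σ).headD b := by
  induction σ with
  | nil => rfl
  | cons x σ ih =>
    rw [top, expandAll]
    split_ifs with h1 h2
    · rfl
    · rw [ih h.2.2] at h2
      rcases hR : expandAll [] σ with _ | ⟨z, R⟩
      · rfl
      · rw [hR] at h2
        simp only [List.headD_cons] at h2
        simp [expand, h2]
    · rw [ih h.2.2] at h2 ⊢
      have h3 := h.2.1 h1
      rcases hR : expandAll [] σ with _ | ⟨z, R⟩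
      · rw [hR] at h2 h3
        exact absurd h3 h2
      · rw [hR] at h2
        simp only [List.headD_cons] at h2
        simp [expand, h2]

theorem isPrimary_of_mem_expand : ∀ {R : List (Part n)} {y : Part n},
    (∀ x ∈ R, x.color.IsPrimary) → ∀ x ∈ expand y R, x.color.IsPrimary := by
  intro R
  induction R with
  | nil => intro y _; simp [expand, up_isPrimary, lo_isPrimary]
  | cons x R ih =>
    intro y h
    simp only [List.mem_cons, forall_eq_or_imp] at h
    rw [expand]
    split_ifs
    · simp only [List.mem_cons, forall_eq_or_imp]
      exact ⟨up_isPrimary _, lo_isPrimary _, h⟩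
    · simp only [List.mem_cons, forall_eq_or_imp]
      exact ⟨h.1, ih h.2⟩

theorem isPrimary_of_mem_expandAll {T σ : List (Part n)} (h : ∀ x ∈ T, x.color.IsPrimary) :
    ∀ x ∈ expandAll T σ, x.color.IsPrimary := by
  induction σ with
  | nil => exact h
  | cons x σ ih =>
    rw [expandAll]
    split_ifs with hx
    · simpa [hx] using ih
    · exact isPrimary_of_mem_expand ih

/-- The part y follows w. As long as both cross the same primary parts, y ≫ w persists by the
symmetry of `gg_iff_halves`. When w splits, the two alternatives of that criterion say that y splits
just before the upper half of w or just after crossing it. -/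
theorem stops_expand {b b' : Part n} : ∀ {R : List (Part n)} {y w : Part n},
    (∀ x ∈ R, x.color.IsPrimary) → ¬ y.color.IsPrimary → ¬ w.color.IsPrimary → y.GG w →
    Stops b w R → Stops b' y (expand w R) := by
  have split : ∀ {y w : Part n} {R : List (Part n)}, ¬ y.color.IsPrimary → ¬ w.color.IsPrimary →
      y.GG w → Stops b' y (w.up :: w.lo :: R) := by
    intro y w R hy hw h
    rw [gg_iff_halves hy hw] at h
    rcases h with h | h
    · exact .inl h
    · have h1 : w.lo.val < (y.shift (-1)).lo.val := by
        rw [lo_shift_neg_one hy, val_shift_neg_one]; omega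
      refine .inr ⟨?_, .inl h1⟩
      simpa using Or.inr h1
  intro R
  induction R with
  | nil => intro y w _ hy hw h _; exact split hy hw h
  | cons x R ih =>
    intro y w hR hy hw h hs
    have hR' := fun z hz => hR z (List.mem_cons_of_mem _ hz)
    rw [expand]
    split_ifs with hx
    · exact split hy hw h
    · rcases hs with hs | ⟨hs, hs'⟩
      · exact absurd hs hx
      · refine .inr ⟨?_, ih hR' hy hw ?_ hs'⟩
        · intro z hz
          left
          rw [gg_iff_of_isPrimary (x := x.shift 1) (.inl (hR x (by simp))), val_shift_one]
          rcases head?_expand (w.shift (-1)) R with h1 | ⟨u, hu, hx', h1⟩ <;> rw [h1] at hz <;>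
              obtain rfl := Option.some.inj hz
          · rw [up_shift_neg_one hw]; omega
          · rw [val_shift_one]
            rcases hs u hu with h2 | h2
            · rw [gg_iff_of_isPrimary (.inl (hR x (by simp)))] at h2
              omega
            · omega
        · rw [gg_iff_halves hy hw] at h
          rw [gg_iff_halves (by exact hy) (by exact hw), up_shift_neg_one hw, up_shift_neg_one hy,
            lo_shift_neg_one hw, lo_shift_neg_one hy, val_shift_neg_one, val_shift_neg_one]
          omega

/-- Converse of `stops_expand`: the place where y splits relative to the halves of w decides which
alternative of `gg_iff_halves` holds, and lowering both parts preserves it. -/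
theorem gg_of_stops {b : Part n} : ∀ {X : List (Part n)} {y w : Part n},
    ¬ y.color.IsPrimary → ¬ w.color.IsPrimary → Stops b y (expand w X) → y.GG w := by
  have split : ∀ {y w : Part n} {X : List (Part n)}, ¬ y.color.IsPrimary → ¬ w.color.IsPrimary →
      Stops b y (w.up :: w.lo :: X) → y.GG w := by
    intro y w X hy hw h
    rw [gg_iff_halves hy hw]
    rcases h with h | ⟨h, -⟩
    · exact .inl h
    · have h1 := h w.lo rfl
      rw [gg_iff_of_isPrimary (.inl w.up_isPrimary), lo_shift_neg_one hy, val_shift_neg_one] at h1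
      have := up_lt_lo_add hw
      omega
  intro X
  induction X with
  | nil => intro y w hy hw h; exact split hy hw h
  | cons x X ih =>
    intro y w hy hw h
    rw [expand] at h
    split_ifs at h with hx
    · exact split hy hw h
    · rw [gg_iff_halves hy hw]
      rcases h with h | ⟨-, h⟩
      · rw [val_shift_one] at h
        have := up_lt_lo_add hw
        omega
      · have := ih (by exact hy) (by exact hw) h
        rw [gg_iff_halves (by exact hy) (by exact hw), up_shift_neg_one hw, up_shift_neg_one hy,
            lo_shift_neg_one hw, lo_shift_neg_one hy, val_shift_neg_one, val_shift_neg_one] at this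
        omega

/-- The bound z already acts as a virtual last part, so appending it changes no comparison. The
splitting takes place before z, hence the new bound b is arbitrary. -/
theorem stops_concat {z b : Part n} : ∀ {G : List (Part n)} {y : Part n},
    Stops z y G → Stops b y (G ++ [z]) ∧ expand y (G ++ [z]) = expand y G ++ [z] := by
  intro G
  induction G with
  | nil =>
    intro y h
    exact ⟨.inl h, by simp [expand, show z.val < y.lo.val from h]⟩
  | cons x G ih =>
    intro y h
    rw [List.cons_append, expand, expand]
    rcases h with h | ⟨h, h'⟩
    · exact ⟨.inl h, by simp [h]⟩
    · refine ⟨.inr ⟨?_, (ih h').1⟩, ?_⟩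
      · rcases G with _ | ⟨u, G⟩
        · intro v hv
          obtain rfl := Option.some.inj hv
          exact .inr h'
        · exact h
      · split_ifs
        · rfl
        · rw [(ih h').2]; rfl

theorem good_concat {z b : Part n} {T Q : List (Part n)} (hQ : Good z T Q)
    (h : ∀ q ∈ Q.getLast?, ∀ x ∈ (T ++ [z]).head?, q.GG x) :
    Good b (T ++ [z]) Q ∧ expandAll (T ++ [z]) Q = expandAll T Q ++ [z] := by
  induction Q with
  | nil => exact ⟨trivial, rfl⟩
  | cons x Q ih =>
    obtain ⟨h1, h2, h3⟩ := hQ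
    have ih' := ih h3 (fun q hq => h q (by
      rcases Q with _ | ⟨_, Q⟩
      · simp at hq
      · simpa using hq))
    refine ⟨⟨?_, ?_, ih'.1⟩, ?_⟩
    · rcases Q with _ | ⟨w, Q⟩
      · exact h x rfl
      · rw [ih'.2]
        intro v hv
        refine h1 v ?_
        have hne : expandAll T (w :: Q) ≠ [] := by
          rw [expandAll]
          split_ifs
          · simp
          · exact expand_ne_nil _ _
        rwa [List.head?_append_of_ne_nil _ hne] at hv
    · intro hx
      rw [ih'.2]
      exact (stops_concat (h2 hx)).1
    · rw [expandAll, expandAll, ih'.2]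
      split_ifs with hx
      · rfl
      · exact (stops_concat (b := b) (h2 hx)).2

/-! ### The machine -/

theorem step1_eq_none {l : List (Part n)} (h : l.IsChain fun x y => ¬ x.Troublesome y) :
    step1 l = none := by
  induction l using step1.induct with
  | case1 x y l hT => exact absurd hT (List.isChain_cons_cons.1 h).1
  | case2 x y l hT ih => rw [step1, if_neg hT, ih (List.isChain_cons_cons.1 h).2]; rfl
  | case3 l hl => rw [step1]; exact hl

theorem step2_eq_none {l : List (Part n)} (h : l.IsChain fun x y => ¬ x.ToCross y) :
    step2 l = none := by
  induction l using step2.induct with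
  | case1 x y l hT => exact absurd hT (List.isChain_cons_cons.1 h).1
  | case2 x y l hT ih => rw [step2, if_neg hT, ih (List.isChain_cons_cons.1 h).2]; rfl
  | case3 l hl => rw [step2]; exact hl

theorem not_troublesome_of_gg {x y : Part n} (h : x.GG y) : ¬ x.Troublesome y := fun h' => h'.2.2.2 h

theorem not_toCross_of_gg {x y : Part n} (h : x.GG y) : ¬ x.ToCross y := fun h' => h'.2.2 h

theorem step1_append_halves {y : Part n} (hy : y.InS) (B : List (Part n)) :
    ∀ {A : List (Part n)}, (A ++ [y.up]).IsChain GG →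
      step1 (A ++ y.up :: y.lo :: B) = some (A ++ y :: B) := by
  intro A
  induction A with
  | nil =>
    intro _
    rw [List.nil_append, step1, if_pos (troublesome_halves hy)]
    obtain ⟨c, h1, h2⟩ := Option.map_eq_some_iff.1 (mul?_halves (not_isPrimary_of_inS hy))
    rw [h1, Option.map_some, h2]
    rfl
  | cons x A ih =>
    intro h
    rcases A with _ | ⟨w, A⟩
    · have h' := List.isChain_cons_cons.1 h
      have := ih h'.2
      simp only [List.nil_append] at this
      rw [List.cons_append, List.nil_append, step1, if_neg (not_troublesome_of_gg h'.1), this]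
      rfl
    · have h' := List.isChain_cons_cons.1 h
      have := ih h'.2
      rw [List.cons_append, List.cons_append, step1, if_neg (not_troublesome_of_gg h'.1),
        ← List.cons_append, this]
      rfl

theorem step2_append_cross {x y : Part n} (hxy : x.ToCross y) (B : List (Part n)) :
    ∀ {A : List (Part n)}, (A ++ [x]).IsChain GG →
      step2 (A ++ x :: y :: B) = some (A ++ y.shift 1 :: x.shift (-1) :: B) := by
  intro A
  induction A with
  | nil =>
    intro _
    rw [List.nil_append, step2, if_pos hxy]
    rfl
  | cons u A ih =>
    intro h
    rcases A with _ | ⟨w, A⟩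
    · have h' := List.isChain_cons_cons.1 h
      have := ih h'.2
      simp only [List.nil_append] at this
      rw [List.cons_append, List.nil_append, step2, if_neg (not_toCross_of_gg h'.1), this]
      rfl
    · have h' := List.isChain_cons_cons.1 h
      have := ih h'.2
      rw [List.cons_append, List.cons_append, step2, if_neg (not_toCross_of_gg h'.1),
        ← List.cons_append, this]
      rfl

theorem iterStep2_of_some {l l' : List (Part n)} (h : step2 l = some l') :
    iterStep2 l = iterStep2 l' := by
  conv_lhs => rw [iterStep2]
  split <;> simp_all

theorem iterStep2_of_none {l : List (Part n)} (h : step2 l = none) : iterStep2 l = l := by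
  rw [iterStep2]
  split <;> simp_all

theorem machinePhi_of_some {l l' : List (Part n)} (h : step1 l = some l') :
    machinePhi l = machinePhi (iterStep2 l') := by
  conv_lhs => rw [machinePhi]
  split <;> simp_all

theorem machinePhi_of_isChain {l : List (Part n)} (h : l.IsChain GG) : machinePhi l = l := by
  have h1 : step1 l = none := step1_eq_none (h.imp fun _ _ => not_troublesome_of_gg)
  rw [machinePhi]
  split <;> simp_all

theorem iterStep2_eq_self {Q R : List (Part n)} {y : Part n} (hy : ¬ y.color.IsPrimary)
    (hQ : (Q ++ [y]).IsChain GG) (hR : ∀ x ∈ R, x.color.IsPrimary) :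
    iterStep2 (Q ++ y :: R) = Q ++ y :: R := by
  apply iterStep2_of_none
  apply step2_eq_none
  rw [List.append_cons, List.isChain_append]
  refine ⟨hQ.imp fun _ _ => not_toCross_of_gg, ?_, ?_⟩
  · have key : ∀ R : List (Part n), (∀ x ∈ R, x.color.IsPrimary) →
        R.IsChain fun x y => ¬ x.ToCross y := by
      intro R hR
      induction R with
      | nil => exact .nil
      | cons x R ih =>
        rw [List.isChain_cons]
        exact ⟨fun z hz h => not_isPrimary_of_inS h.2.1
          (hR z (List.mem_cons_of_mem _ (List.mem_of_mem_head? hz))),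
          ih fun z hz => hR z (List.mem_cons_of_mem _ hz)⟩
    exact key R hR
  · intro x hx z hz h
    simp only [List.getLast?_append, List.getLast?_singleton, Option.some_or,
      Option.mem_some_iff] at hx
    subst hx
    exact hy h.1.1

/-- Step 1 followed by Step 2 turns the halves of a secondary part back into that part. -/
theorem machine_expand {b : Part n} : ∀ {R Q : List (Part n)} {y : Part n}, y.InS →
    (∀ x ∈ R, x.InP) → Stops b y R → (∀ h ∈ (expand y R).head?, (Q ++ [h]).IsChain GG) →
    (∀ x ∈ R.head?, y.lo.val ≤ x.val → x.val + period n < y.val) →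
    ∃ s, step1 (Q ++ expand y R) = some s ∧ iterStep2 s = iterStep2 (Q ++ y :: R) := by
  intro R
  induction R with
  | nil =>
    intro Q y hy _ _ hQ _
    exact ⟨_, step1_append_halves hy [] (hQ _ rfl), rfl⟩
  | cons x R ih =>
    intro Q y hy hR hs hQ hc
    have hp := not_isPrimary_of_inS hy
    have hN := period_pos (n := n)
    simp only [List.mem_cons, forall_eq_or_imp] at hR
    rw [expand] at hQ ⊢
    split_ifs at hQ ⊢ with hx
    · exact ⟨_, step1_append_halves hy _ (hQ _ rfl), rfl⟩
    · rcases hs with hs | ⟨hs, hs'⟩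
      · exact absurd hs hx
      have hc' := hc x rfl (not_lt.1 hx)
      have hQ' := hQ _ rfl
      have hy' : (y.shift (-1)).InS := inS_shift_neg_one hy hR.1 hc'.le (not_lt.1 hx)
      -- The hypothesis x + 1 ≺ y is inherited: if y - 1 also crosses u, then u + 1 ⪯ x ≺ y - 1.
      have hnext : ∀ u ∈ R.head?, (y.shift (-1)).lo.val ≤ u.val → u.val + period n ≤ x.val := by
        intro u hu hu'
        rcases hs u hu with h | h
        · rwa [gg_iff_of_isPrimary (.inl hR.1.1)] at h
        · omega
      obtain ⟨s, h1, h2⟩ := ih (Q := Q ++ [x.shift 1]) hy' hR.2 hs' (by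
        intro h hh
        rw [List.isChain_append]
        refine ⟨hQ', .singleton _, ?_⟩
        intro v hv w hw
        simp only [List.getLast?_append, List.getLast?_singleton, Option.some_or,
          Option.mem_some_iff, List.head?_cons] at hv hw
        subst hv hw
        rw [gg_iff_of_isPrimary (x := x.shift 1) (.inl hR.1.1), val_shift_one]
        rcases head?_expand (y.shift (-1)) R with h1 | ⟨u, hu, hx', h1⟩ <;> rw [h1] at hh <;>
          obtain rfl := Option.some.inj hh
        · rw [up_shift_neg_one hp]; omega
        · have := hnext u hu hx'
          rw [val_shift_one]; omega) (by
        intro u hu hu'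
        have := hnext u hu hu'
        rw [val_shift_neg_one]
        omega)
      refine ⟨s, by simpa using h1, h2.trans ?_⟩
      -- By induction y - 1 is formed behind x + 1; one more application of Step 2 restores (y, x).
      have hcross : (x.shift 1).ToCross (y.shift (-1)) := by
        refine ⟨⟨hR.1.1, ?_⟩, hy', ?_⟩
        · have := hR.1.2
          rw [shift_size]; omega
        · rw [gg_iff_of_isPrimary (x := x.shift 1) (.inl hR.1.1), val_shift_one, val_shift_neg_one]
          omega
      rw [List.append_assoc, List.singleton_append,
        iterStep2_of_some (step2_append_cross hcross R hQ'), shift_neg_one_one, shift_one_neg_one]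

theorem machinePhi_expand {b : Part n} {R Q : List (Part n)} {y : Part n} (hy : y.InS)
    (hR : ∀ x ∈ R, x.InP) (hs : Stops b y R)
    (hQ : ∀ h ∈ (expand y R).head?, (Q ++ [h]).IsChain GG)
    (hc : ∀ x ∈ R.head?, y.lo.val ≤ x.val → x.val + period n < y.val)
    (hQy : (Q ++ [y]).IsChain GG) :
    machinePhi (Q ++ expand y R) = machinePhi (Q ++ y :: R) := by
  obtain ⟨s, h1, h2⟩ := machine_expand hy hR hs hQ hc
  rw [machinePhi_of_some h1, h2,
    iterStep2_eq_self (not_isPrimary_of_inS hy) hQy fun x hx => (hR x hx).1]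

theorem isChain_expand : ∀ {R : List (Part n)} {y : Part n}, ¬ y.color.IsPrimary →
    R.IsChain LexGt → (expand y R).IsChain LexGt := by
  intro R
  induction R with
  | nil =>
    intro y hy _
    simpa [expand, lexGt_iff] using lo_lt_up hy
  | cons x R ih =>
    intro y hy hR
    rw [expand]
    split_ifs with hx
    · simpa [List.isChain_cons_cons (a := y.up), List.isChain_cons_cons (a := y.lo), lexGt_iff, hx,
        lo_lt_up hy] using hR
    · rw [List.isChain_cons] at hR ⊢
      refine ⟨fun z hz => ?_, ih (by exact hy) hR.2⟩
      rw [lexGt_iff, val_shift_one]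
      rcases head?_expand (y.shift (-1)) R with h1 | ⟨u, hu, hx', h1⟩ <;> rw [h1] at hz <;>
        obtain rfl := Option.some.inj hz
      · rw [up_shift_neg_one hy]
        have := period_pos (n := n)
        omega
      · have := hR.1 u hu
        rw [lexGt_iff] at this
        rw [val_shift_one]
        omega

/-! ### Rebuilding a partition from its split sequence -/

section Zero

variable [NeZero n]

/-- 0_{a_n} is the largest primary colored number of size 0, so as a bound it encodes positivity of
sizes. -/
theorem zeroPart_lt_iff {x : Part n} (hx : x.color.IsPrimary) :
    (zeroPart n).val < x.val ↔ 1 ≤ x.size := by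
  rcases x with ⟨m, i | ⟨i, j, _⟩⟩
  · rw [val_lt_iff]
    have h : (i : ℕ) ≤ (⊤ : Fin n) := Fin.le_def.1 le_top
    simp only [zeroPart, Color.fstIdx, Color.sndIdx]
    omega
  · exact absurd hx (by simp [Color.IsPrimary])

theorem zeroPart_lt_lo {y : Part n} (hy : y.InS) : (zeroPart n).val < y.lo.val :=
  (zeroPart_lt_iff y.lo_isPrimary).2 ((lo_size_pos_iff (not_isPrimary_of_inS hy)).2 hy.2)

/-- In a suitable sequence, every secondary part is split before the end. -/
theorem stops_expandAll : ∀ {σ : List (Part n)} {y : Part n}, y.InS → (∀ x ∈ σ, x.InP ∨ x.InS) →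
    (y :: σ).IsChain GG → Good (zeroPart n) [] σ → Stops (zeroPart n) y (expandAll [] σ) := by
  intro σ
  induction σ with
  | nil => intro y hy _ _ _; exact zeroPart_lt_lo hy
  | cons x σ ih =>
    intro y hy hσ hc hg
    have hp := not_isPrimary_of_inS hy
    rw [List.isChain_cons_cons] at hc
    simp only [List.mem_cons, forall_eq_or_imp] at hσ
    rw [expandAll]
    split_ifs with hx
    · by_cases hlt : x.val < y.lo.val
      · exact .inl hlt
      have hP : x.InP := hσ.1.resolve_right fun h => not_isPrimary_of_inS h hx
      have hyx := (gg_iff_of_isPrimary (.inr hx)).1 hc.1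
      refine .inr ⟨fun z hz => .inl (hg.1 z hz), ih ?_ hσ.2 ?_ hg.2.2⟩
      · exact inS_shift_neg_one hy hP hyx (not_lt.1 hlt)
      · rw [List.isChain_cons] at hc ⊢
        refine ⟨fun w hw => ?_, hc.2.2⟩
        have hxw := (gg_iff_of_isPrimary (.inl hx)).1 (hc.2.1 w hw)
        by_cases hwp : w.color.IsPrimary
        · rw [gg_iff_of_isPrimary (.inr hwp), val_shift_neg_one]
          omega
        -- y - 1 ⪰ x ⪰ w + 1, and x = w + 1 is impossible since x is primary and w is not.
        · refine gg_of_val hp ?_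
          have := val_ne_of_isPrimary (x := x) (y := w.shift 1) hx hwp
          rw [val_shift_one] at this
          rw [val_shift_neg_one]
          omega
    · exact stops_expand (isPrimary_of_mem_expandAll (by simp)) hp hx hc.1 (hg.2.1 hx)

theorem inP_of_mem_expand : ∀ {R : List (Part n)} {y : Part n}, ¬ y.color.IsPrimary →
    (∀ x ∈ R, x.InP) → Stops (zeroPart n) y R → ∀ x ∈ expand y R, x.InP := by
  have key : ∀ {y : Part n}, ¬ y.color.IsPrimary → (zeroPart n).val < y.lo.val →
      y.up.InP ∧ y.lo.InP := fun {y} hy h =>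
    have h1 := (zeroPart_lt_iff y.lo_isPrimary).1 h
    ⟨⟨y.up_isPrimary, h1.trans (lo_size_le_up_size hy)⟩, y.lo_isPrimary, h1⟩
  intro R
  induction R with
  | nil =>
    intro y hy _ h
    have := key hy h
    simp [expand, this]
  | cons x R ih =>
    intro y hy hR h
    simp only [List.mem_cons, forall_eq_or_imp] at hR
    rw [expand]
    split_ifs with hx
    · have := key hy (((zeroPart_lt_iff hR.1.1).2 hR.1.2).trans hx)
      simpa [this, hR.1] using hR.2
    · rcases h with h | ⟨-, h⟩
      · exact absurd h hx
      · simp only [List.mem_cons, forall_eq_or_imp]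
        refine ⟨⟨hR.1.1, ?_⟩, ih (by exact hy) hR.2 h⟩
        have := hR.1.2
        rw [shift_size]
        omega

theorem expandAll_mem_setO {σ : List (Part n)} (hσ : ∀ x ∈ σ, x.InP ∨ x.InS)
    (hg : Good (zeroPart n) [] σ) : expandAll [] σ ∈ setO n := by
  induction σ with
  | nil => exact ⟨by simp [expandAll], .nil⟩
  | cons x σ ih =>
    simp only [List.mem_cons, forall_eq_or_imp] at hσ
    obtain ⟨h1, h2⟩ := ih hσ.2 hg.2.2
    rw [expandAll]
    split_ifs with hx
    · refine ⟨?_, ?_⟩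
      · simpa [hσ.1.resolve_right fun h => not_isPrimary_of_inS h hx] using h1
      · rw [List.isChain_cons]
        exact ⟨fun z hz => (lexGt_iff _ _).2 (val_lt_of_gg (hg.1 z hz)), h2⟩
    · exact ⟨inP_of_mem_expand hx h1 (hg.2.1 hx), isChain_expand hx h2⟩

/-- The machine rebuilds the secondary parts from left to right, with one round of Steps 1 and 2 for
each. The induction is on the suffix still split, behind a prefix Q already equal to that of ν. -/
theorem machinePhi_expandAll {ν : List (Part n)} (hν : ν ∈ setE n) (hg : Good (zeroPart n) [] ν) :
    machinePhi (expandAll [] ν) = ν := by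
  have key : ∀ σ Q, Q ++ σ = ν → machinePhi (Q ++ expandAll [] σ) = ν := by
    intro σ
    induction σ with
    | nil =>
      intro Q hQ
      rw [expandAll, hQ]
      exact machinePhi_of_isChain hν.2
    | cons y σ ih =>
      intro Q hQ
      have ih' := ih (Q ++ [y]) (by simpa using hQ)
      rw [expandAll]
      split_ifs with hy
      · simpa using ih'
      · subst hQ
        have hg' := good_append.1 hg
        have hm : ∀ x ∈ σ, x.InP ∨ x.InS := fun x hx => hν.1 x (by simp [hx])
        have hO := expandAll_mem_setO hm hg'.2.2.2
        have hS : y.InS := (hν.1 y (by simp)).resolve_left fun h => hy h.1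
        have hc := List.isChain_append.1 hν.2
        rw [List.append_assoc, List.singleton_append] at ih'
        rw [← ih']
        refine machinePhi_expand hS hO.1 (hg'.2.2.1 hy) ?_ ?_ ?_
        · intro h hh
          rw [List.isChain_append]
          refine ⟨hc.1, .singleton _, ?_⟩
          intro x hx z hz
          obtain rfl : h = z := by simpa using hz
          exact hg'.1.gg_of_getLast? x hx h (by rwa [expandAll, if_neg hy])
        · intro x hx _
          have hxp := (hO.1 x (List.mem_of_mem_head? hx)).1
          have h1 := hg'.2.1 x hx
          rw [gg_iff_of_isPrimary (.inr hxp)] at h1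
          have := val_ne_of_isPrimary (x := x.shift 1) (y := y) hxp hy
          rw [val_shift_one] at this
          omega
        · have h := hν.2
          rw [List.append_cons, List.isChain_append] at h
          exact h.1
  exact key ν [] rfl

end Zero

/-! ### Goodness as an invariant of the machine -/

/-- After Step 1, the new secondary part moves to the left until it is well related to the
preceding part. -/
theorem exists_iterStep2 {b : Part n} {R : List (Part n)} (hR : ∀ x ∈ R, x.color.IsPrimary) :
    ∀ {Q X : List (Part n)} {y : Part n}, (∀ x ∈ Q, x.InP ∨ x.InS) → Q.IsChain GG →
    Good b (expand y X) Q → y.InS → (∀ x ∈ X, x.InP) → (y :: X).IsChain GG →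
    (∀ x ∈ X.head?, y.lo.val ≤ x.val) → Stops b y X →
    (∀ w ∈ (y :: X).getLast?, b.val < w.val ∧ (¬ w.color.IsPrimary → b.val + period n < w.val)) →
    ∃ P, iterStep2 (Q ++ y :: X ++ R) = P ++ R ∧ (∀ x ∈ P, x.InP ∨ x.InS) ∧ P.IsChain GG ∧
      Good b [] P ∧
      ∀ w ∈ P.getLast?, b.val < w.val ∧ (¬ w.color.IsPrimary → b.val + period n < w.val) := by
  -- Final position: the part on the left of y is ≫ y, and Step 2 stops. X holds the primary parts
  -- that y has crossed.
  have fin : ∀ {Q X : List (Part n)} {y : Part n}, (∀ x ∈ Q, x.InP ∨ x.InS) → Q.IsChain GG →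
      Good b (expand y X) Q → y.InS → (∀ x ∈ X, x.InP) → (y :: X).IsChain GG → Stops b y X →
      (∀ w ∈ (y :: X).getLast?, b.val < w.val ∧
        (¬ w.color.IsPrimary → b.val + period n < w.val)) →
      (∀ x ∈ Q.getLast?, x.GG y) →
      ∃ P, iterStep2 (Q ++ y :: X ++ R) = P ++ R ∧ (∀ x ∈ P, x.InP ∨ x.InS) ∧ P.IsChain GG ∧
        Good b [] P ∧
        ∀ w ∈ P.getLast?, b.val < w.val ∧ (¬ w.color.IsPrimary → b.val + period n < w.val) := by
    intro Q X y hQ hQc hg hy hX hc hs hl hQy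
    have hp := not_isPrimary_of_inS hy
    have hXp : ∀ x ∈ X, x.color.IsPrimary := fun x hx => (hX x hx).1
    refine ⟨Q ++ y :: X, ?_, ?_, ?_, ?_, ?_⟩
    · rw [List.append_assoc, List.cons_append]
      refine iterStep2_eq_self hp ?_ ?_
      · rw [List.isChain_append]
        refine ⟨hQc, .singleton _, fun x hx z hz => ?_⟩
        obtain rfl : y = z := by simpa using hz
        exact hQy x hx
      · intro x hx
        rcases List.mem_append.1 hx with hx | hx
        · exact hXp x hx
        · exact hR x hx
    · intro x hx
      rcases List.mem_append.1 hx with hx | hx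
      · exact hQ x hx
      · rcases List.mem_cons.1 hx with rfl | hx
        · exact .inr hy
        · exact .inl (hX x hx)
    · rw [List.isChain_append]
      refine ⟨hQc, hc, fun x hx z hz => ?_⟩
      obtain rfl : y = z := by simpa using hz
      exact hQy x hx
    · have he : expandAll [] X = X := by rw [expandAll_eq_append hXp, List.append_nil]
      rw [good_append, expandAll, if_neg hp, he]
      refine ⟨hg, ?_, ?_, ?_⟩
      · rw [he]; exact (List.isChain_cons.1 hc).1
      · rw [he]; exact fun _ => hs
      · exact good_of_isChain hXp (List.isChain_cons.1 hc).2
    · rw [List.getLast?_append_of_ne_nil _ (by simp)]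
      exact hl
  intro Q
  induction Q using List.reverseRecOn with
  | nil =>
    intro X y hQ hQc hg hy hX hc _ hs hl
    exact fin hQ hQc hg hy hX hc hs hl (by simp)
  | append_singleton Q x ih =>
    intro X y hQ hQc hg hy hX hc hlo hs hl
    have hp := not_isPrimary_of_inS hy
    have hN := period_pos (n := n)
    by_cases hcross : x.ToCross y
    swap
    · refine fin hQ hQc hg hy hX hc hs hl fun w hw => ?_
      obtain rfl : x = w := by simpa using hw
      rcases hQ x (by simp) with hx | hx
      · by_contra h
        exact hcross ⟨hx, hy, h⟩
      -- A secondary x is never an obstacle: it splits properly within the expansion of y, which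
      -- forces x ≫ y.
      · exact gg_of_stops (not_isPrimary_of_inS hx) hp
          ((good_append.1 hg).2.2.1 (not_isPrimary_of_inS hx))
    · obtain ⟨hx, -, hxy⟩ := hcross
      obtain ⟨hg1, hg2⟩ := good_append.1 hg
      rw [expandAll, if_pos hx.1, expandAll] at hg1
      rw [gg_iff_of_isPrimary (.inl hx.1), not_le] at hxy
      have hy1 : ¬ (y.shift 1).color.IsPrimary := hp
      have hlo1 : (y.shift 1).lo = y.up := by
        rw [← up_shift_neg_one hy1, shift_one_neg_one]
      have hhead : ∀ h ∈ (expand y X).head?, h.val + period n ≤ x.val := fun h hh =>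
        (gg_iff_of_isPrimary (.inl hx.1)).1 (hg2.1 h hh)
      have hup : y.up.val + period n ≤ x.val := by
        obtain ⟨h, hh⟩ : ∃ h, h ∈ (expand y X).head? := by
          rcases head?_expand y X with h | ⟨u, -, -, h⟩ <;> exact ⟨_, h⟩
        have := hhead h hh
        have := up_le_of_mem_head?_expand hp hh
        omega
      have hxX : ∀ u ∈ X.head?, (x.shift (-1)).GG u := by
        intro u hu
        have hu' := hlo u hu
        obtain ⟨X, rfl⟩ := List.head?_eq_some_iff.1 hu
        have := hhead (u.shift 1) (by simp [expand, hu'.not_gt])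
        rw [val_shift_one] at this
        rw [gg_iff_of_isPrimary (x := x.shift (-1)) (.inl hx.1), val_shift_neg_one]
        omega
      -- The invariant of the move: the split form of the sequence does not change under a crossing.
      have hex : expand (y.shift 1) (x.shift (-1) :: X) = x :: expand y X := by
        rw [expand, if_neg, shift_neg_one_one, shift_one_neg_one]
        rw [hlo1, val_shift_neg_one]
        omega
      have hx1 : (x.shift (-1)).InP := by
        refine ⟨hx.1, ?_⟩
        have h1 := (lo_size_pos_iff hp).2 hy.2
        have h2 := lo_size_le_up_size hp
        by_contra h
        have h3 : (x.shift (-1)).size < y.up.size := by omega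
        have := val_lt_of_size_lt h3
        rw [val_shift_neg_one] at this
        omega
      have hc1 := List.isChain_append.1 hQc
      obtain ⟨P, h1, h2⟩ := ih (X := x.shift (-1) :: X) (y := y.shift 1)
        (fun z hz => hQ z (by simp [hz])) hc1.1 (by rwa [hex])
        ⟨hy.1, by have := hy.2; rw [shift_size]; omega⟩
        (by simpa [hx1] using hX)
        (by
          rw [List.isChain_cons_cons, List.isChain_cons]
          refine ⟨?_, hxX, (List.isChain_cons.1 hc).2⟩
          rw [gg_iff_of_isPrimary (y := x.shift (-1)) (.inr hx.1), val_shift_one, val_shift_neg_one]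
          omega)
        (by
          intro z hz
          obtain rfl := Option.some.inj hz
          rw [hlo1, val_shift_neg_one]
          omega)
        (.inr ⟨fun z hz => .inl (hxX z hz), by rwa [shift_one_neg_one]⟩)
        (by
          intro w hw
          rcases X with _ | ⟨u, X⟩
          · obtain rfl : x.shift (-1) = w := by simpa using hw
            refine ⟨?_, fun h => absurd hx.1 h⟩
            have h1 : b.val < y.lo.val := hs
            have := lo_lt_up hp
            rw [val_shift_neg_one]
            omega
          · exact hl w (by simpa using hw))
      refine ⟨P, ?_, h2⟩
      rw [← h1]
      have := step2_append_cross ⟨hx, hy, by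
        rw [gg_iff_of_isPrimary (.inl hx.1)]; omega⟩ (X ++ R) hQc
      simpa using iterStep2_of_some this

/-- The upper half has positive size, so the size of y is at least that of its lower half plus one.
Colors matter only when y has size 2; then a b of size 1 has a color below the first factor of that
of y. -/
theorem add_period_lt_of_lt_lo {b y : Part n} (hb : b.color.IsPrimary) (hy : y.InS)
    (h : b.val < y.lo.val) : b.val + period n < y.val := by
  obtain ⟨hy, hs⟩ := hy
  rw [Color.isSecondary_iff] at hy
  rw [← val_shift_one]
  rcases b with ⟨m, i | ⟨i, j, _⟩⟩
  swap
  · exact absurd hb (by simp [Color.IsPrimary])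
  obtain ⟨k', i', j', hc', rfl | rfl⟩ := exists_parity hy <;>
  simp only [val_lt_iff, lo_even, lo_odd, shift, Color.fstIdx, Color.sndIdx] at hs h ⊢ <;> omega

/-! ### The image of the machine and its local conditions -/

section Characterization

variable [NeZero n]

/-- The machine turns a suitable sequence, followed by primary parts, into a suitable sequence. -/
theorem good_machinePhi : ∀ {R P : List (Part n)}, R ∈ setO n → P ∈ setE n →
    Good (R.headD (zeroPart n)) [] P →
    (∀ w ∈ P.getLast?, (R.headD (zeroPart n)).val < w.val ∧
      (¬ w.color.IsPrimary → (R.headD (zeroPart n)).val + period n < w.val)) →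
    machinePhi (P ++ R) ∈ setE n ∧ Good (zeroPart n) [] (machinePhi (P ++ R)) := by
  intro R
  induction R with
  | nil =>
    intro P _ hP hg _
    rw [List.append_nil, machinePhi_of_isChain hP.2]
    exact ⟨hP, hg⟩
  | cons z R ih =>
    intro P hR hP hg hl
    rw [List.headD_cons] at hg hl
    have hRm := hR.1
    simp only [List.mem_cons, forall_eq_or_imp] at hRm
    have hRc := List.isChain_cons.1 hR.2
    have hR' : R ∈ setO n := ⟨hRm.2, hRc.2⟩
    have hb : (R.headD (zeroPart n)).color.IsPrimary ∧ (R.headD (zeroPart n)).val < z.val := by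
      rcases R with _ | ⟨r, R⟩
      · exact ⟨trivial, (zeroPart_lt_iff hRm.1.1).2 hRm.1.2⟩
      · exact ⟨(hRm.2 r (by simp)).1, (lexGt_iff _ _).1 (hRc.1 r rfl)⟩
    by_cases hT : ∃ x ∈ P.getLast?, x.Troublesome z
    · obtain ⟨x, hx, hT⟩ := hT
      obtain ⟨Q, rfl⟩ := List.getLast?_eq_some_iff.1 hx
      obtain ⟨y, hy, rfl, rfl⟩ := exists_of_troublesome hT
      have hQc := (List.isChain_append.1 hP.2).1
      have hgQ : Good (R.headD (zeroPart n)) (expand y []) Q := by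
        have h1 := (good_append.1 hg).1
        simp only [expandAll, if_pos y.up_isPrimary] at h1
        -- Before the sum, the upper half is the last part of the prefix and the lower half is the
        -- bound. Appending the bound gives exactly the split form of y.
        refine (good_concat h1 fun q hq u hu => ?_).1
        exact h1.gg_of_getLast? q hq u (by simpa using hu)
      obtain ⟨P', h1, h2, h3, h4, h5⟩ := exists_iterStep2 (b := R.headD (zeroPart n)) (R := R)
        (fun x hx => (hRm.2 x hx).1) (fun x hx => hP.1 x (by simp [hx])) hQc hgQ hy
        (by simp) (.singleton _) (by simp) hb.2 (by
          intro w hw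
          obtain rfl : y = w := by simpa using hw
          have := add_period_lt_of_lt_lo hb.1 hy hb.2
          have := period_pos (n := n)
          exact ⟨by omega, fun _ => by omega⟩)
      have hstep := step1_append_halves hy R hP.2
      rw [List.append_assoc, List.singleton_append, machinePhi_of_some hstep]
      rw [List.append_assoc, List.singleton_append] at h1
      rw [h1]
      exact ih hR' ⟨h2, h3⟩ h4 h5
    -- For a primary last part, ≻ without a troublesome pair is ≫. For a secondary one the invariant
    -- carries the extra unit.
    · have hPz : ∀ x ∈ P.getLast?, x.GG z := by
        intro x hx
        by_contra h
        obtain ⟨h1, h2⟩ := hl x hx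
        rcases hP.1 x (List.mem_of_getLast? hx) with hx' | hx'
        · exact hT ⟨x, hx, hx', hRm.1, (lexGt_iff _ _).2 h1, h⟩
        · rw [gg_iff_of_isPrimary (.inr hRm.1.1)] at h
          have := h2 (not_isPrimary_of_inS hx')
          omega
      have hgood := (good_concat (b := R.headD (zeroPart n)) hg fun q hq u hu => by
        obtain rfl : z = u := by simpa using hu
        exact hPz q hq).1
      rw [List.append_cons]
      refine ih hR' ⟨?_, ?_⟩ ?_ ?_
      · intro x hx
        rcases List.mem_append.1 hx with hx | hx
        · exact hP.1 x hx
        · obtain rfl := List.mem_singleton.1 hx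
          exact .inl hRm.1
      · rw [List.isChain_append]
        refine ⟨hP.2, .singleton _, fun x hx u hu => ?_⟩
        obtain rfl : z = u := by simpa using hu
        exact hPz x hx
      · rw [good_append]
        simp only [expandAll, if_pos hRm.1.1]
        exact ⟨hgood, good_of_isChain (by simpa using hRm.1.1) (.singleton _)⟩
      · intro w hw
        obtain rfl : z = w := by simpa using hw
        exact ⟨hb.2, fun h => absurd hRm.1.1 h⟩

theorem mem_image_machinePhi_iff {ν : List (Part n)} (hν : ν ∈ setE n) :
    ν ∈ machinePhi '' setO n ↔ Good (zeroPart n) [] ν := by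
  constructor
  · rintro ⟨l, hl, rfl⟩
    exact (good_machinePhi (P := []) hl ⟨by simp, .nil⟩ trivial (by simp)).2
  · intro h
    exact ⟨_, expandAll_mem_setO hν.1 h, machinePhi_expandAll hν h⟩

/-- The condition on the first part that crosses a given secondary part. -/
def CrossCondition (ν : List (Part n)) : Prop :=
  ∀ Q y σ, ν = Q ++ y :: σ → ¬ y.color.IsPrimary → y.lo.val ≤ (top (zeroPart n) σ).val →
    (∀ q ∈ Q.getLast?, q.GG ((top (zeroPart n) σ).shift 1)) ∧
      (top (zeroPart n) σ).val + period n < y.val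

/-- The first part of the split form of y :: σ is either the upper half of y, where ≫ is inherited
by `gg_up_of_gg`, or the crossing part raised by one, where ≫ is the condition. Proper splitting
costs nothing, by `stops_expandAll`. -/
theorem good_iff_crossCondition {ν : List (Part n)} (hν : ν ∈ setE n) :
    Good (zeroPart n) [] ν ↔ CrossCondition ν := by
  constructor
  · rintro hg Q y σ rfl hy hlo
    obtain ⟨hg1, hg2⟩ := good_append.1 hg
    have hprim := isPrimary_of_mem_expandAll (T := ([] : List (Part n))) (σ := σ) (by simp)
    rw [hg2.2.2.top_eq] at hlo ⊢
    rw [expandAll, if_neg hy] at hg1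
    have h2 := hg2.1
    have h3 := hg2.2.1 hy
    rcases hR : expandAll [] σ with _ | ⟨z, R⟩
    · rw [hR] at h3 hlo
      exact absurd (show (zeroPart n).val < y.lo.val from h3) (not_lt.2 hlo)
    · rw [hR] at hg1 hlo h2 hprim
      rw [List.headD_cons] at hlo ⊢
      have hz := hprim z (by simp)
      refine ⟨fun q hq => hg1.gg_of_getLast? q hq _ (by simp [expand, hlo.not_gt]), ?_⟩
      have h4 := (gg_iff_of_isPrimary (.inr hz)).1 (h2 z rfl)
      have := val_ne_of_isPrimary (x := z.shift 1) (y := y) hz hy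
      rw [val_shift_one] at this
      omega
  · intro hc
    have key : ∀ σ Q, ν = Q ++ σ → Good (zeroPart n) [] σ := by
      intro σ
      induction σ with
      | nil => intro _ _; trivial
      | cons x σ ih =>
        intro Q hQ
        have hg := ih (Q ++ [x]) (by simpa using hQ)
        subst hQ
        have hch := (List.isChain_append.1 hν.2).2.1
        refine ⟨?_, fun hx => ?_, hg⟩
        · rcases σ with _ | ⟨y, σ⟩
          · simp [expandAll]
          have hxy := (List.isChain_cons_cons.1 hch).1
          rw [expandAll]
          split_ifs with hy
          · simpa using hxy
          · have hS : y.InS := (hν.1 y (by simp)).resolve_left fun h => hy h.1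
            intro z hz
            rcases head?_expand y (expandAll [] σ) with h1 | ⟨u, hu, hlo, h1⟩ <;> rw [h1] at hz <;>
              obtain rfl := Option.some.inj hz
            · exact gg_up_of_gg hS hxy
            · have htop : top (zeroPart n) σ = u := by
                rw [hg.2.2.top_eq, List.headD_eq_head?_getD, hu]; rfl
              have := (hc (Q ++ [x]) y σ (by simp) hy (by rwa [htop])).1 x (by simp)
              rwa [htop] at this
        · have hS : x.InS := (hν.1 x (by simp)).resolve_left fun h => hx h.1
          exact stops_expandAll hS (fun z hz => hν.1 z (by simp [hz])) hch hg
    exact key ν [] rfl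

/-- The condition on the first part that crosses a given troublesome secondary part. -/
def TroublesomeCondition (ν : List (Part n)) : Prop :=
  ∀ Q y w σ, ν = Q ++ y :: w :: σ → ¬ y.color.IsPrimary → ¬ w.color.IsPrimary →
    (∀ q ∈ Q.getLast?, q.Tri y) → ¬ y.Tri w →
      y.lo.val ≤ (top (zeroPart n) (w :: σ)).val →
        (top (zeroPart n) (w :: σ)).val + period n < y.val

theorem top_isPrimary (σ : List (Part n)) : (top (zeroPart n) σ).color.IsPrimary := by
  induction σ with
  | nil => trivial
  | cons x σ ih =>
    rw [top]
    split_ifs with h1 h2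
    · exact h1
    · exact up_isPrimary _
    · exact ih

theorem crossCondition_iff {ν : List (Part n)} (hν : ν ∈ setE n) :
    CrossCondition ν ↔ TroublesomeCondition ν := by
  constructor
  · intro h Q y w σ hν hy _ _ _ hlo
    exact (h Q y (w :: σ) hν hy hlo).2
  intro hT
  have hN := period_pos (n := n)
  -- Removes the hypothesis on the left neighbor q. If q ▷ y fails, the part t that crosses y also
  -- crosses q, so t + 2 ≺ q by induction; since q ⊁ y + 1, this gives t + 1 ≺ y.
  have left : ∀ Q y w σ, ν = Q ++ y :: w :: σ → ¬ y.color.IsPrimary → ¬ w.color.IsPrimary →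
      ¬ y.Tri w → y.lo.val ≤ (top (zeroPart n) (w :: σ)).val →
        (top (zeroPart n) (w :: σ)).val + period n < y.val := by
    intro Q
    induction Q using List.reverseRecOn with
    | nil =>
      intro y w σ h hy hw hyw
      exact hT [] y w σ h hy hw (by simp) hyw
    | append_singleton Q q ih =>
      intro y w σ h hy hw hyw hlo
      by_cases hq : q.Tri y
      · exact hT _ y w σ h hy hw (by simpa using hq) hyw hlo
      · have hqy : q.GG y := by
          have h2 := hν.2
          rw [h, List.append_assoc, List.singleton_append] at h2
          exact (List.isChain_cons_cons.1 (List.isChain_append.1 h2).2.1).1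
        have hqp : ¬ q.color.IsPrimary := fun h1 => hq (by
          rwa [tri_iff_of_isPrimary (.inl h1), ← gg_iff_of_isPrimary (.inl h1)])
        have htop : top (zeroPart n) (y :: w :: σ) = (top (zeroPart n) (w :: σ)).shift 1 := by
          rw [top, if_neg hy, if_neg hlo.not_gt]
        have h1 := lo_le_of_not_tri hqp hy hqy hq
        have h2 := ih q y (w :: σ) (by simpa using h) hqp hy hq (by
          rw [htop, val_shift_one]; omega)
        rw [htop, val_shift_one] at h2
        rw [tri_iff_of_not_isPrimary hqp hy] at hq
        omega
  -- Removes the hypothesis on the right neighbor w. If y ▷ w, it is enough that the arriving part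
  -- is below w: it is the upper half of w, or it has crossed w and induction applies.
  have right : ∀ σ Q y, ν = Q ++ y :: σ → ¬ y.color.IsPrimary →
      y.lo.val ≤ (top (zeroPart n) σ).val → (top (zeroPart n) σ).val + period n < y.val := by
    intro σ
    induction σ with
    | nil =>
      intro Q y h hy hlo
      have hS : y.InS := (hν.1 y (by simp [h])).resolve_left fun h => hy h.1
      exact absurd (zeroPart_lt_lo hS) hlo.not_gt
    | cons w σ ih =>
      intro Q y h hy hlo
      have hyw : y.GG w := by
        have h2 := hν.2
        rw [h] at h2
        exact (List.isChain_cons_cons.1 (List.isChain_append.1 h2).2.1).1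
      by_cases hw : w.color.IsPrimary
      · rw [top, if_pos hw]
        have h1 := (gg_iff_of_isPrimary (.inr hw)).1 hyw
        have := val_ne_of_isPrimary (x := w.shift 1) (y := y) hw hy
        rw [val_shift_one] at this
        omega
      · by_cases htri : y.Tri w
        · rw [tri_iff_of_not_isPrimary hy hw] at htri
          have hS : w.InS := (hν.1 w (by simp [h])).resolve_left fun h => hw h.1
          rw [top, if_neg hw]
          split_ifs with h1
          · have := up_val_lt hS
            omega
          · have := ih (Q ++ [y]) w (by simpa using h) hw (not_lt.1 h1)
            rw [val_shift_one]
            omega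
        · exact left Q y w σ h hy hw htri hlo
  intro Q y σ h hy hlo
  have h1 := right σ Q y h hy hlo
  refine ⟨fun q hq => ?_, h1⟩
  obtain ⟨Q, rfl⟩ := List.getLast?_eq_some_iff.1 hq
  have hqy : q.GG y := by
    have h2 := hν.2
    rw [h, List.append_assoc, List.singleton_append] at h2
    exact (List.isChain_cons_cons.1 (List.isChain_append.1 h2).2.1).1
  rw [gg_iff_of_isPrimary (y := (top (zeroPart n) σ).shift 1) (.inr (top_isPrimary σ)), val_shift_one]
  by_cases hqp : q.color.IsPrimary
  · rw [gg_iff_of_isPrimary (.inl hqp)] at hqy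
    omega
  · by_cases hq : q.Tri y
    · rw [tri_iff_of_not_isPrimary hqp hy] at hq
      omega
    -- When ▷ fails, the same part crosses q next, and `right` at q is the required bound.
    · have h2 := lo_le_of_not_tri hqp hy hqy hq
      have htop : top (zeroPart n) (y :: σ) = (top (zeroPart n) σ).shift 1 := by
        rw [top, if_neg hy, if_neg hlo.not_gt]
      have h3 := right (y :: σ) Q q (by simpa using h) hqp (by
          rw [htop, val_shift_one]; omega)
      rw [htop, val_shift_one] at h3
      omega

end Characterization

/-! ### Enumeration and Bridge -/

theorem entries_of_isPrimary {x : Part n} (h : x.color.IsPrimary) : x.entries = [(x, .whole)] := by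
  rcases x with ⟨m, i | ⟨i, j, _⟩⟩
  · rfl
  · exact absurd h (by simp [Color.IsPrimary])

theorem entries_of_not_isPrimary {x : Part n} (h : ¬ x.color.IsPrimary) :
    x.entries = [(x.up, .upper), (x.lo, .lower)] := by
  rcases x with ⟨m, i | ⟨i, j, _⟩⟩
  · exact absurd trivial h
  · rfl

theorem enum_append (Q σ : List (Part n)) : enum (Q ++ σ) = enum Q ++ enum σ := by
  simp [enum]

theorem enum_cons (x : Part n) (σ : List (Part n)) : enum (x :: σ) = x.entries ++ enum σ := by
  simp [enum]

theorem length_enum_concat (Q : List (Part n)) (x : Part n) :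
    (enum (Q ++ [x])).length = (enum Q).length + if x.color.IsPrimary then 1 else 2 := by
  rw [enum_append, List.length_append, enum_cons]
  split_ifs with h
  · simp [entries_of_isPrimary h, enum]
  · simp [entries_of_not_isPrimary h, enum]

theorem mem_setI_iff (ν : List (Part n)) (k : ℕ) :
    k ∈ setI ν ↔ ((enum ν)[k]?).map Prod.snd = some .upper := by
  rw [setI, Finset.mem_filter, List.getElem?_map, Finset.mem_range]
  refine ⟨And.right, fun h => ⟨?_, h⟩⟩
  by_contra hk
  rw [List.getElem?_eq_none (not_lt.1 hk)] at h
  simp at h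

theorem mem_setJ_iff (ν : List (Part n)) (k : ℕ) :
    k ∈ setJ ν ↔ ((enum ν)[k]?).map Prod.snd = some .whole := by
  rw [setJ, Finset.mem_filter, List.getElem?_map, Finset.mem_range]
  refine ⟨And.right, fun h => ⟨?_, h⟩⟩
  by_contra hk
  rw [List.getElem?_eq_none (not_lt.1 hk)] at h
  simp at h

theorem getElem?_enum_append (Q σ : List (Part n)) (k : ℕ) :
    (enum (Q ++ σ))[(enum Q).length + k]? = (enum σ)[k]? := by
  rw [enum_append, List.getElem?_append_right (by omega), Nat.add_sub_cancel_left]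

theorem exists_of_mem_setI {ν : List (Part n)} : ∀ {i : ℕ}, i ∈ setI ν →
    ∃ Q y σ, ν = Q ++ y :: σ ∧ ¬ y.color.IsPrimary ∧ i = (enum Q).length := by
  induction ν with
  | nil => intro i hi; simp [mem_setI_iff, enum] at hi
  | cons x ν ih =>
    intro i hi
    have shift : ∀ k, i = x.entries.length + k → k ∈ setI ν := by
      rintro k rfl
      rw [mem_setI_iff] at hi ⊢
      rwa [enum_cons, List.getElem?_append_right (by omega), Nat.add_sub_cancel_left] at hi
    have next : ∀ k, i = x.entries.length + k →
        ∃ Q y σ, x :: ν = Q ++ y :: σ ∧ ¬ y.color.IsPrimary ∧ i = (enum Q).length := by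
      intro k hk
      obtain ⟨Q, y, σ, rfl, hy, rfl⟩ := ih (shift k hk)
      exact ⟨x :: Q, y, σ, rfl, hy, by rw [hk, enum_cons, List.length_append]⟩
    by_cases hx : x.color.IsPrimary
    · have he := entries_of_isPrimary hx
      rcases i with _ | k
      · simp [mem_setI_iff, enum_cons, he] at hi
      · exact next k (by simp [he]; omega)
    · have he := entries_of_not_isPrimary hx
      rcases i with _ | _ | k
      · exact ⟨[], x, ν, rfl, hx, rfl⟩
      · simp [mem_setI_iff, enum_cons, he] at hi
      · exact next k (by simp [he]; omega)

theorem length_mem_setI_iff (Q σ : List (Part n)) :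
    (enum Q).length ∈ setI (Q ++ σ) ↔ ∃ y ∈ σ.head?, ¬ y.color.IsPrimary := by
  rw [mem_setI_iff]
  have := getElem?_enum_append Q σ 0
  rw [add_zero] at this
  rw [this]
  rcases σ with _ | ⟨y, σ⟩
  · simp [enum]
  · by_cases hy : y.color.IsPrimary
    · simp [enum_cons, entries_of_isPrimary hy, hy]
    · simp [enum_cons, entries_of_not_isPrimary hy, hy]

/-- A secondary part gives two entries, exactly one of them in I, so subtracting the earlier
elements of I counts each part once. -/
theorem partPos_length (Q σ : List (Part n)) : partPos (Q ++ σ) (enum Q).length = Q.length := by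
  have key : ∀ Q σ : List (Part n), (enum Q).length =
      Q.length + ((setI (Q ++ σ)).filter (· < (enum Q).length)).card := by
    intro Q
    induction Q using List.reverseRecOn with
    | nil => intro σ; simp [enum]
    | append_singleton Q x ih =>
      intro σ
      have ih' := ih (x :: σ)
      rw [List.append_assoc, List.singleton_append, length_enum_concat]
      split_ifs with hx
      · have : (setI (Q ++ x :: σ)).filter (· < (enum Q).length + 1) =
            (setI (Q ++ x :: σ)).filter (· < (enum Q).length) := by
          ext k
          simp only [Finset.mem_filter]
          refine and_congr_right fun hk => ⟨fun h => ?_, fun h => by omega⟩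
          by_contra h'
          obtain rfl : k = (enum Q).length := by omega
          simpa [hx] using (length_mem_setI_iff _ _).1 hk
        rw [this, List.length_append, List.length_singleton]
        omega
      · have : (setI (Q ++ x :: σ)).filter (· < (enum Q).length + 2) =
            insert (enum Q).length ((setI (Q ++ x :: σ)).filter (· < (enum Q).length)) := by
          ext k
          simp only [Finset.mem_filter, Finset.mem_insert]
          constructor
          · rintro ⟨hk, h⟩
            by_contra! h'
            have h2 := h'.2 hk
            obtain rfl : k = (enum Q).length + 1 := by omega
            rw [mem_setI_iff, getElem?_enum_append] at hk
            simp [enum_cons, entries_of_not_isPrimary hx] at hk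
          · rintro (rfl | ⟨h1, h2⟩)
            · exact ⟨(length_mem_setI_iff _ _).2 (by simpa using hx), by omega⟩
            · exact ⟨h1, by omega⟩
        rw [this, Finset.card_insert_of_notMem (by simp), List.length_append,
          List.length_singleton]
        omega
  rw [partPos]
  have := key Q σ
  omega

theorem leftPart_length (Q σ : List (Part n)) :
    leftPart (Q ++ σ) (enum Q).length = Q.getLast? := by
  rw [leftPart, partPos_length]
  rcases Q.eq_nil_or_concat with rfl | ⟨Q, x, rfl⟩
  · rfl
  · simp

/-- The number of secondary parts before the first primary part. -/
def leading : List (Part n) → ℕ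
  | [] => 0
  | x :: σ => if x.color.IsPrimary then 0 else leading σ + 1

theorem leading_spec {σ : List (Part n)} : ∀ Q : List (Part n),
    (∀ k, k < 2 * leading σ → (enum Q).length + k ∉ setJ (Q ++ σ) ∧
      (enum Q).length + k < (enum (Q ++ σ)).length ∧
      ((enum Q).length + k ∈ setI (Q ++ σ) ↔ Even k)) ∧
    ((enum Q).length + 2 * leading σ ∈ setJ (Q ++ σ) ∨
      (enum (Q ++ σ)).length ≤ (enum Q).length + 2 * leading σ) := by
  induction σ with
  | nil => intro Q; simp [leading]
  | cons x σ ih =>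
    intro Q
    rw [leading]
    split_ifs with hx
    · refine ⟨fun k hk => by omega, .inl ?_⟩
      rw [mem_setJ_iff, getElem?_enum_append]
      simp [enum_cons, entries_of_isPrimary hx]
    · obtain ⟨h1, h2⟩ := ih (Q ++ [x])
      rw [List.append_assoc, List.singleton_append, length_enum_concat, if_neg hx] at h1 h2
      refine ⟨fun k hk => ?_, ?_⟩
      · rcases k with _ | _ | k
        · simp [mem_setJ_iff, mem_setI_iff, enum_cons, enum_append,
            entries_of_not_isPrimary hx]
        · simp [mem_setJ_iff, mem_setI_iff, enum_cons, enum_append,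
            entries_of_not_isPrimary hx]
        · have := h1 k (by omega)
          rw [show (enum Q).length + 2 + k = (enum Q).length + (k + 1 + 1) by ring] at this
          rw [this.2.2]
          exact ⟨this.1, this.2.1, by simp [parity_simps]⟩
      · rwa [show (enum Q).length + 2 + 2 * leading σ =
          (enum Q).length + 2 * (leading σ + 1) by ring] at h2

theorem nextPrimary_length {Q σ : List (Part n)} {y : Part n} (hy : ¬ y.color.IsPrimary) :
    nextPrimary (Q ++ y :: σ) (enum Q).length = (enum Q).length + 2 * leading (y :: σ) := by
  obtain ⟨h1, h2⟩ := leading_spec (σ := y :: σ) Q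
  have h3 : 0 < leading (y :: σ) := by rw [leading, if_neg hy]; omega
  rw [nextPrimary, Nat.find_eq_iff]
  refine ⟨⟨by omega, h2⟩, ?_⟩
  rintro k hk ⟨hk1, hk2⟩
  obtain ⟨k, rfl⟩ := Nat.exists_eq_add_of_lt hk1
  have := h1 (k + 1) (by omega)
  rw [← add_assoc] at this
  rcases hk2 with hk2 | hk2
  · exact this.1 hk2
  · omega

/-! ### The Bridge as the origin of the crossing part -/

section Bridge

variable [NeZero n]

theorem secPart_length (Q σ : List (Part n)) (y : Part n) :
    secPart (Q ++ y :: σ) (enum Q).length = y := by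
  rw [secPart, partPos_length]
  simp

/-- Valid past the end too, where both sides are the default 0_{a_n}; the index just after the last
entry needs this. -/
theorem entry_length_add (Q σ : List (Part n)) (k : ℕ) :
    entry (Q ++ σ) ((enum Q).length + k) = entry σ k := by
  simp only [entry, List.getD_eq_getElem?_getD, List.getElem?_map, getElem?_enum_append]

/-- The number of secondary parts crossed by the part that arrives first at the left end. -/
def crossed : List (Part n) → ℕ
  | [] => 0
  | x :: σ =>
      if x.color.IsPrimary then 0
      else if (top (zeroPart n) σ).val < x.lo.val then 0 else crossed σ + 1

theorem crossed_le_leading (σ : List (Part n)) : crossed σ ≤ leading σ := by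
  induction σ with
  | nil => exact le_rfl
  | cons x σ ih => rw [crossed, leading]; split_ifs <;> omega

/-- Peels off the index of y. Its constraint has the offset (u - i')/2 - 1 = m, the number of
secondary parts between y and u, each of which has raised the moving part by one. -/
theorem crossing_succ {Q σ : List (Part n)} {y : Part n} (hy : ¬ y.color.IsPrimary) (m : ℕ) :
    Crossing (Q ++ y :: σ) (enum Q).length ((enum Q).length + 2 * (m + 1)) ↔
      y.lo.val ≤ (entry σ (2 * m)).val + m * period n ∧
      Crossing (Q ++ y :: σ) (enum (Q ++ [y])).length
        ((enum (Q ++ [y])).length + 2 * m) := by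
  have hlen := length_enum_concat Q y
  rw [if_neg hy] at hlen
  have hu : (enum Q).length + 2 * (m + 1) = (enum (Q ++ [y])).length + 2 * m := by omega
  have he : entry (Q ++ y :: σ) ((enum Q).length + 2 * (m + 1)) = entry σ (2 * m) := by
    rw [hu, List.append_cons, entry_length_add]
  have hlo : entry (Q ++ y :: σ) ((enum Q).length + 1) = y.lo := by
    rw [entry_length_add]
    simp [entry, enum_cons, entries_of_not_isPrimary hy]
  have hm : (((enum Q).length + 2 * (m + 1) : ℕ) - ((enum Q).length : ℤ)) / 2 - 1 = m := by
    push_cast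
    omega
  have h0 : (enum Q).length ∈ setI (Q ++ y :: σ) :=
    (length_mem_setI_iff _ _).2 (by simpa using hy)
  have h1 : (enum Q).length + 1 ∉ setI (Q ++ y :: σ) := by
    rw [mem_setI_iff, getElem?_enum_append]
    simp [enum_cons, entries_of_not_isPrimary hy]
  constructor
  · intro h
    refine ⟨?_, ?_⟩
    · have := h _ h0 le_rfl (by omega)
      rwa [hlo, he, hm, lexGt_iff, not_lt, val_shift] at this
    · rw [← hu]
      exact fun i hi h2 h3 => h i hi (by omega) h3
  · rintro ⟨h2, h3⟩ i hi h4 h5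
    rcases Nat.lt_or_ge i ((enum Q).length + 2) with h6 | h6
    · obtain rfl | rfl : i = (enum Q).length ∨ i = (enum Q).length + 1 := by omega
      · rwa [hlo, he, hm, lexGt_iff, not_lt, val_shift]
      · exact absurd hi h1
    · rw [hu] at h5 ⊢
      exact h3 i hi (by omega) h5

theorem crossing_self (ν : List (Part n)) (i : ℕ) : Crossing ν i i :=
  fun _ _ h1 h2 => absurd h1 (by omega)

/-- The maximality of `crossed` needs the bound on values in the induction: every admissible
candidate arrives at most as large as `top`, so a secondary part not crossed by `top` is crossed by
none. -/
theorem crossing_spec {σ : List (Part n)} : ∀ Q : List (Part n),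
    Crossing (Q ++ σ) (enum Q).length ((enum Q).length + 2 * crossed σ) ∧
    (entry σ (2 * crossed σ)).shift (crossed σ) = top (zeroPart n) σ ∧
    ∀ m ≤ leading σ, Crossing (Q ++ σ) (enum Q).length ((enum Q).length + 2 * m) →
      m ≤ crossed σ ∧ (entry σ (2 * m)).val + m * period n ≤ (top (zeroPart n) σ).val := by
  induction σ with
  | nil =>
    intro Q
    refine ⟨crossing_self _ _, by simp [crossed, entry, enum, top], fun m hm _ => ?_⟩
    obtain rfl : m = 0 := by simpa [leading] using hm
    simp [entry, enum, top]
  | cons x σ ih =>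
    intro Q
    by_cases hx : x.color.IsPrimary
    · rw [crossed, leading, top, if_pos hx, if_pos hx, if_pos hx]
      have he : entry (x :: σ) 0 = x := by simp [entry, enum_cons, entries_of_isPrimary hx]
      refine ⟨crossing_self _ _, by simp [he], fun m hm _ => ?_⟩
      obtain rfl : m = 0 := by omega
      simp [he]
    · obtain ⟨h1, h2, h3⟩ := ih (Q ++ [x])
      rw [List.append_assoc, List.singleton_append] at h1 h3
      have he : entry (x :: σ) 0 = x.up := by simp [entry, enum_cons, entries_of_not_isPrimary hx]
      have he' : ∀ k, entry (x :: σ) (2 * (k + 1)) = entry σ (2 * k) := by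
        intro k
        simp only [entry, enum_cons, entries_of_not_isPrimary hx]
        rfl
      have hval : (entry σ (2 * crossed σ)).val + crossed σ * period n =
          (top (zeroPart n) σ).val := by rw [← h2, val_shift]
      have hup := up_lt_lo_add hx
      rw [crossed, leading, top, if_neg hx, if_neg hx, if_neg hx]
      split_ifs with hlt
      · refine ⟨crossing_self _ _, by simp [he], fun m hm hc => ?_⟩
        rcases m with _ | m
        · simp [he]
        · obtain ⟨h4, h5⟩ := (crossing_succ hx m).1 hc
          have := (h3 m (by omega) h5).2
          omega
      · refine ⟨(crossing_succ hx _).2 ⟨by omega, h1⟩, ?_, fun m hm hc => ?_⟩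
        · rw [he', ← h2, shift_shift]
          push_cast
          rfl
        · rcases m with _ | m
          · rw [mul_zero, he, val_shift_one]
            simp
            omega
          · obtain ⟨h4, h5⟩ := (crossing_succ hx m).1 hc
            have := h3 m (by omega) h5
            rw [he', val_shift_one]
            refine ⟨by omega, ?_⟩
            push_cast
            linarith [this.2]

/-- Up to the next primary part the elements of I lie at even distances 2m from i. The three cases
of the definition are the largest admissible m being that of the next primary part, a smaller
positive number, or 0. -/
theorem bridge_length {Q σ : List (Part n)} {y : Part n} (hy : ¬ y.color.IsPrimary) :
    bridge (Q ++ y :: σ) (enum Q).length = (enum Q).length + 2 * crossed (y :: σ) := by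
  obtain ⟨h1, -, h3⟩ := crossing_spec (σ := y :: σ) Q
  obtain ⟨h4, -⟩ := leading_spec (σ := y :: σ) Q
  have hle := crossed_le_leading (y :: σ)
  rw [bridge, nextPrimary_length hy]
  have hcand : ∀ u ∈ candidates (Q ++ y :: σ) (enum Q).length,
      u ≤ (enum Q).length + 2 * crossed (y :: σ) := by
    intro u hu
    simp only [candidates, Finset.mem_filter, nextPrimary_length hy] at hu
    obtain ⟨hu1, hu2, hu3, hu4⟩ := hu
    obtain ⟨k, rfl⟩ := Nat.exists_eq_add_of_le hu2.le
    obtain ⟨m, rfl⟩ := (even_iff_exists_two_mul).1 ((h4 k (by omega)).2.2.1 hu1)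
    have := (h3 m (by omega) hu4).1
    omega
  split_ifs with hc hne
  · have := (h3 _ le_rfl hc).1
    omega
  · refine le_antisymm (Finset.max'_le _ _ _ hcand) ?_
    rcases Nat.eq_zero_or_pos (crossed (y :: σ)) with h0 | h0
    · obtain ⟨u, hu⟩ := hne
      have := hcand u hu
      have hu' := Finset.le_max' _ u hu
      simp only [candidates, Finset.mem_filter] at hu
      omega
    · refine Finset.le_max' _ _ ?_
      simp only [candidates, Finset.mem_filter, nextPrimary_length hy]
      have hlt : crossed (y :: σ) < leading (y :: σ) :=
        lt_of_le_of_ne hle fun h => hc (h ▸ h1)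
      exact ⟨(h4 _ (by omega)).2.2.2 (by simp), by omega, by omega, h1⟩
  · by_contra h
    have h0 : 0 < crossed (y :: σ) := by omega
    refine hne ⟨(enum Q).length + 2 * crossed (y :: σ), ?_⟩
    simp only [candidates, Finset.mem_filter, nextPrimary_length hy]
    have hlt : crossed (y :: σ) < leading (y :: σ) :=
      lt_of_le_of_ne hle fun h => hc (h ▸ h1)
    exact ⟨(h4 _ (by omega)).2.2.2 (by simp), by omega, by omega, h1⟩

theorem lt_bridge_length_iff {Q σ : List (Part n)} {y : Part n} (hy : ¬ y.color.IsPrimary) :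
    (enum Q).length < bridge (Q ++ y :: σ) (enum Q).length ↔
      y.lo.val ≤ (top (zeroPart n) σ).val := by
  rw [bridge_length hy, crossed, if_neg hy]
  split_ifs with h
  · simpa using h
  · simpa using h

theorem bridgePart_length {Q σ : List (Part n)} {y : Part n} (hy : ¬ y.color.IsPrimary)
    (h : y.lo.val ≤ (top (zeroPart n) σ).val) :
    bridgePart (Q ++ y :: σ) (enum Q).length = (top (zeroPart n) σ).shift 1 := by
  have h2 := (crossing_spec (σ := y :: σ) Q).2.1
  rw [bridgePart, bridge_length hy, entry_length_add]
  have hm : (((enum Q).length + 2 * crossed (y :: σ) : ℕ) - ((enum Q).length : ℤ)) / 2 =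
      crossed (y :: σ) := by
    push_cast
    omega
  rw [hm, h2, top, if_neg hy, if_neg h.not_gt]

theorem crossCondition_iff_bridge (ν : List (Part n)) :
    CrossCondition ν ↔ ∀ i ∈ setI ν, bridge ν i > i →
      LeftRel GG ν i (bridgePart ν i) ∧ ¬ (bridgePart ν i).LexGt (secPart ν i) := by
  have step : ∀ {Q σ : List (Part n)} {y : Part n}, ¬ y.color.IsPrimary →
      y.lo.val ≤ (top (zeroPart n) σ).val →
      ((LeftRel GG (Q ++ y :: σ) (enum Q).length (bridgePart (Q ++ y :: σ) (enum Q).length) ∧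
        ¬ (bridgePart (Q ++ y :: σ) (enum Q).length).LexGt
          (secPart (Q ++ y :: σ) (enum Q).length)) ↔
      ((∀ q ∈ Q.getLast?, q.GG ((top (zeroPart n) σ).shift 1)) ∧
        (top (zeroPart n) σ).val + period n < y.val)) := by
    intro Q σ y hy hlo
    rw [bridgePart_length hy hlo, secPart_length, LeftRel, leftPart_length, lexGt_iff,
      val_shift_one, not_lt]
    -- The bridge part is primary and cannot equal the secondary part, so ⊁ is the strict
    -- inequality.
    have := val_ne_of_isPrimary (x := (top (zeroPart n) σ).shift 1) (top_isPrimary σ) hy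
    rw [val_shift_one] at this
    refine and_congr Iff.rfl ?_
    omega
  constructor
  · intro h i hi hb
    obtain ⟨Q, y, σ, rfl, hy, rfl⟩ := exists_of_mem_setI hi
    have hlo := (lt_bridge_length_iff hy).1 hb
    exact (step hy hlo).2 (h Q y σ rfl hy hlo)
  · rintro h Q y σ rfl hy hlo
    exact (step hy hlo).1 (h _ ((length_mem_setI_iff _ _).2 (by simpa using hy))
      ((lt_bridge_length_iff hy).2 hlo))

theorem troublesomeCondition_iff_bridge (ν : List (Part n)) :
    TroublesomeCondition ν ↔ ∀ i ∈ troublesomeSec ν, bridge ν i > i →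
      (secPart ν i).LexGt (bridgePart ν i) := by
  have mem : ∀ {Q σ : List (Part n)} {y : Part n}, ¬ y.color.IsPrimary →
      ((enum Q).length ∈ troublesomeSec (Q ++ y :: σ) ↔ (∀ q ∈ Q.getLast?, q.Tri y) ∧
        ∃ w ∈ σ.head?, ¬ w.color.IsPrimary ∧ ¬ y.Tri w) := by
    intro Q σ y hy
    have hlen : (enum Q).length + 2 = (enum (Q ++ [y])).length := by
      rw [length_enum_concat, if_neg hy]
    have h0 : (enum Q).length ∈ setI (Q ++ y :: σ) :=
      (length_mem_setI_iff _ _).2 (by simpa using hy)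
    have h2 : (enum Q).length + 2 ∈ setI (Q ++ y :: σ) ↔ ∃ w ∈ σ.head?, ¬ w.color.IsPrimary := by
      rw [hlen, List.append_cons, length_mem_setI_iff]
    simp only [troublesomeSec, Set.mem_ofPred_eq, h0, true_and, h2, LeftRel, leftPart_length,
      secPart_length]
    refine and_congr Iff.rfl ?_
    rcases σ with _ | ⟨w, σ⟩
    · simp
    · have h3 : secPart (Q ++ y :: w :: σ) ((enum Q).length + 2) = w := by
        rw [hlen, List.append_cons, secPart_length]
      simp [h3]
  have step : ∀ {Q σ : List (Part n)} {y : Part n}, ¬ y.color.IsPrimary →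
      y.lo.val ≤ (top (zeroPart n) σ).val →
      ((secPart (Q ++ y :: σ) (enum Q).length).LexGt
        (bridgePart (Q ++ y :: σ) (enum Q).length) ↔
        (top (zeroPart n) σ).val + period n < y.val) := by
    intro Q σ y hy hlo
    rw [bridgePart_length hy hlo, secPart_length, lexGt_iff, val_shift_one]
  constructor
  · intro h i hi hb
    obtain ⟨Q, y, σ, rfl, hy, rfl⟩ := exists_of_mem_setI hi.1
    have hlo := (lt_bridge_length_iff hy).1 hb
    obtain ⟨h1, w, hw, hwp, hyw⟩ := (mem hy).1 hi
    obtain ⟨σ, rfl⟩ := List.head?_eq_some_iff.1 hw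
    exact (step hy hlo).2 (h Q y w σ rfl hy hwp h1 hyw hlo)
  · rintro h Q y w σ rfl hy hwp h1 hyw hlo
    exact (step hy hlo).1 (h _ ((mem hy).2 ⟨h1, w, rfl, hwp, hyw⟩)
      ((lt_bridge_length_iff hy).2 hlo))

end Bridge

end ColoredPartition

theorem mainTheorem2 (n : ℕ) [NeZero n] (ν : List (Part n)) (hν : ν ∈ setE n) :
    List.TFAE [
      ν ∈ machinePhi '' setO n,
      ∀ i ∈ setI ν, bridge ν i > i →
        LeftRel Part.GG ν i (bridgePart ν i) ∧ ¬ (bridgePart ν i).LexGt (secPart ν i),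
      ∀ i ∈ troublesomeSec ν, bridge ν i > i →
        (secPart ν i).LexGt (bridgePart ν i)] := by
  rw [← crossCondition_iff_bridge, ← troublesomeCondition_iff_bridge, ← crossCondition_iff hν,
    mem_image_machinePhi_iff hν, good_iff_crossCondition hν]
  simp
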